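/- Let $X$ be a compact Riemann surface with a smooth conformal metric $g$, written $g=r\,|dz|^2=r(dx^2+dy^2)$ in a local holomorphic coordinate $z$, with Gauss curvature $K(g)$ and area measure $d\mu$. Let $\beta=b\,\partial_z\otimes d\bar z$ be a smooth section of $T^{1,0}X\otimes (T^{0,1}X)^*$, and let $C,T\in\mathbb R$. Let $|\partial u|^2=\frac{2}{r}|u_z|^2$ be the Hermitian norm induced by $g$. For $B=b\,\partial_z\otimes d\bar z$ let $B^*=r\,\bar b\,dz^2$ be its metric dual. For a quadratic differential $a\,dz^2$ put $|a\,dz^2|_g^2=\kappa |a|^2/r^2$, where $\kappa>0$ is an arbitrary fixed normalisation constant, and put $|B|^2=|B^*|_g^2$. For smooth $u:X\to\mathbb R$ and smooth sections $f$ of $T^{1,0}X$ define $$\hat{\mathcal D}(u,f)=\int_X\Big[|\partial u|^2+K(g)\,u+e^{2u}|\beta+\bar\partial f|^2\Big]d\mu+C .$$ Suppose that $(u,f)$ is a critical point of $\hat{\mathcal D}$ under the constraint $\int_X e^{2u}\,d\mu=T$: it satisfies the constraint, and the derivative of $\hat{\mathcal D}$ at $(u,f)$ vanishes along every smooth one-parameter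 family of smooth pairs that satisfy the constraint and pass through $(u,f)$. Then there is a constant $\lambda\in\mathbb R$ such that: 1. $\lambda/2$ is a Lagrange multiplier: $(u,f)$ is an unconstrained critical point, along all smooth one-parameter families of smooth pairs, of $$\mathcal D(u,f)=\int_X\Big[|\partial u|^2+K(g)\,u+e^{2u}\big(-\tfrac{\lambda}{2}+|\beta+\bar\partial f|^2\big)\Big]d\mu+C ;$$ 2. the metric $h=e^{2u}g$ and the quadratic differential $\alpha=e^{2u}(\beta+\bar\partial f)^*=e^{2u}(\beta^*+\partial f^*)$ solve the Gauss–Codazzi equations with constant $\lambda$: $\alpha$ is a holomorphic quadratic differential on $X$, and $$K(h)=\lambda-2|\alpha|_h^2 ,$$ where $|\alpha|_h^2$ is taken with respect to $h$ with the same normalisation $\kappa$. -/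

import Mathlib

open scoped Manifold ContDiff
open MeasureTheory

namespace CMC

noncomputable section

/-- The Wirtinger derivative `∂F/∂z = (F_x - i F_y) / 2`. -/
def wirtinger (F : ℂ → ℂ) (z : ℂ) : ℂ :=
  (1 / 2 : ℂ) * (fderiv ℝ F z 1 - Complex.I * fderiv ℝ F z Complex.I)

/-- The Wirtinger derivative `∂F/∂z̄ = (F_x + i F_y) / 2`. -/
def wirtingerBar (F : ℂ → ℂ) (z : ℂ) : ℂ :=
  (1 / 2 : ℂ) * (fderiv ℝ F z 1 + Complex.I * fderiv ℝ F z Complex.I)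

/-- A family of complex coefficient functions, one for each holomorphic coordinate `φ` of `X`;
only the values `t φ z` with `φ` in the atlas and `z ∈ φ.target` are meaningful. -/
abbrev LocalCoeffs (X : Type*) [TopologicalSpace X] : Type _ :=
  OpenPartialHomeomorph X ℂ → ℂ → ℂ

section
variable {X : Type*} [TopologicalSpace X] [ChartedSpace ℂ X]

/-- The coefficients `t` in the various holomorphic coordinates define one section of the line
bundle `(T^{1,0}X)^p ⊗ (T^{0,1}X)^q` (negative exponents are dual bundles): if `φ` and `ψ` are
coordinates and `τ = dψ/dφ`, then `t^ψ = τ^p * (conj τ)^q * t^φ`.  Vector fields `f ∂_z` have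
`(p, q) = (1, 0)`, tensors `b ∂_z ⊗ dz̄` have `(1, -1)`, quadratic differentials `a dz²` have
`(-2, 0)`. -/
def IsTensor (p q : ℤ) (t : LocalCoeffs X) : Prop :=
  ∀ φ ∈ atlas ℂ X, ∀ ψ ∈ atlas ℂ X, ∀ x ∈ φ.source ∩ ψ.source,
    t ψ (ψ x) = deriv (ψ ∘ φ.symm) (φ x) ^ p *
      (starRingEnd ℂ) (deriv (ψ ∘ φ.symm) (φ x)) ^ q * t φ (φ x)

/-- A (real-)smooth section of `(T^{1,0}X)^p ⊗ (T^{0,1}X)^q`. -/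
structure IsSmoothTensor (p q : ℤ) (t : LocalCoeffs X) : Prop where
  transform : IsTensor p q t
  smooth : ∀ φ ∈ atlas ℂ X, ContDiffOn ℝ ∞ (t φ) φ.target

/-- A holomorphic quadratic differential `a dz²`. -/
structure IsHolomorphicQuadraticDifferential (a : LocalCoeffs X) : Prop where
  transform : IsTensor (-2) 0 a
  holomorphic : ∀ φ ∈ atlas ℂ X, DifferentiableOn ℂ (a φ) φ.target

/-- A smooth Riemannian metric on `X` in the conformal class of its complex structure, given in
the coordinate `z = φ` by `g φ z * (dx² + dy²) = g φ z * |dz|²`. -/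
structure IsConformalMetric (g : OpenPartialHomeomorph X ℂ → ℂ → ℝ) : Prop where
  pos : ∀ φ ∈ atlas ℂ X, ∀ z ∈ φ.target, 0 < g φ z
  smooth : ∀ φ ∈ atlas ℂ X, ContDiffOn ℝ ∞ (g φ) φ.target
  transform : ∀ φ ∈ atlas ℂ X, ∀ ψ ∈ atlas ℂ X, ∀ x ∈ φ.source ∩ ψ.source,
    g φ (φ x) = ‖deriv (ψ ∘ φ.symm) (φ x)‖ ^ 2 * g ψ (ψ x)

/-- Gauss curvature of `r |dz|²` in the coordinate `φ`: `K = -Δ(log r) / (2 r)`. -/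
def gaussCurvature (g : OpenPartialHomeomorph X ℂ → ℂ → ℝ)
    (φ : OpenPartialHomeomorph X ℂ) (z : ℂ) : ℝ :=
  -(Laplacian.laplacian (fun w => Real.log (g φ w)) z) / (2 * g φ z)

/-- The conformally changed metric `e^{2u} g`. -/
def conformalChange (u : X → ℝ) (g : OpenPartialHomeomorph X ℂ → ℂ → ℝ) :
    OpenPartialHomeomorph X ℂ → ℂ → ℝ :=
  fun φ z => Real.exp (2 * u (φ.symm z)) * g φ z

/-- The area measure of the metric `r |dz|²`, which is `r dx dy` in every coordinate: the least
measure that dominates, for each coordinate `φ`, the image on `X` of `r dx dy` on `φ.target`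
(these images agree on overlaps). -/
def areaMeasure [MeasurableSpace X] (g : OpenPartialHomeomorph X ℂ → ℂ → ℝ) : Measure X :=
  ⨆ φ ∈ atlas ℂ X, Measure.map φ.symm
    ((volume.restrict φ.target).withDensity (fun z => ENNReal.ofReal (g φ z)))

/-- `|∂u|²_g = |u_z|² |dz|²_g` with `|dz|²_g = |dx|²_g + |dy|²_g = 2 / r` for `g = r |dz|²`. -/
def normSqPartial (g : OpenPartialHomeomorph X ℂ → ℂ → ℝ) (u : X → ℝ)
    (φ : OpenPartialHomeomorph X ℂ) (z : ℂ) : ℝ :=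
  2 / g φ z * ‖wirtinger (fun w => (u (φ.symm w) : ℂ)) z‖ ^ 2

/-- `∂̄f` for a section `f ∂_z` of `T^{1,0}X`: the tensor `(∂f/∂z̄) ∂_z ⊗ dz̄`. -/
def dbar (f : LocalCoeffs X) : LocalCoeffs X :=
  fun φ z => wirtingerBar (f φ) z

/-- The metric dual `b* = r (conj b) dz²` of `b ∂_z ⊗ dz̄` with respect to `g = r |dz|²`. -/
def conjDual (g : OpenPartialHomeomorph X ℂ → ℂ → ℝ) (b : LocalCoeffs X) : LocalCoeffs X :=
  fun φ z => (g φ z : ℂ) * (starRingEnd ℂ) (b φ z)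

/-- The pointwise norm `|a dz²|²_g = κ |a|² / r²` for `g = r |dz|²`, where `κ > 0` is the
normalisation `κ = r² |dz²|²_g` (e.g. `κ = 4` for the tensor norm of `dz ⊗ dz`, and `κ = 2` if
`K = k + c² - 2 |α|²` is to be the Gauss equation of a surface with second fundamental form
`α + c h + conj α`). -/
def normSqQuad (κ : ℝ) (g : OpenPartialHomeomorph X ℂ → ℂ → ℝ) (a : LocalCoeffs X)
    (φ : OpenPartialHomeomorph X ℂ) (z : ℂ) : ℝ :=
  κ * ‖a φ z‖ ^ 2 / g φ z ^ 2

/-- The pointwise norm of `b ∂_z ⊗ dz̄`, for which `b ↦ b*` is isometric. -/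
def normSqBeltrami (κ : ℝ) (g : OpenPartialHomeomorph X ℂ → ℂ → ℝ) (b : LocalCoeffs X)
    (φ : OpenPartialHomeomorph X ℂ) (z : ℂ) : ℝ :=
  normSqQuad κ g (conjDual g b) φ z

/-- The value at the point `x` of a scalar quantity given in coordinates. -/
def atPoint (s : OpenPartialHomeomorph X ℂ → ℂ → ℝ) (x : X) : ℝ :=
  s (chartAt ℂ x) (chartAt ℂ x x)

/-- The area `∫ e^{2u} dμ` of `X` in the metric `e^{2u} g`. -/
def area [MeasurableSpace X] (g : OpenPartialHomeomorph X ℂ → ℂ → ℝ) (u : X → ℝ) : ℝ :=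
  ∫ x, Real.exp (2 * u x) ∂(areaMeasure g)

/-- The functional `∫ [|∂u|² + K(g) u + e^{2u} |β + ∂̄f|²] dμ + C`. -/
def reducedFunctional [MeasurableSpace X] (κ : ℝ) (g : OpenPartialHomeomorph X ℂ → ℂ → ℝ)
    (β : LocalCoeffs X) (C : ℝ) (u : X → ℝ) (f : LocalCoeffs X) : ℝ :=
  (∫ x, (atPoint (normSqPartial g u) x + atPoint (gaussCurvature g) x * u x +
      Real.exp (2 * u x) * atPoint (normSqBeltrami κ g (β + dbar f)) x) ∂(areaMeasure g)) + C

/-- The functional `∫ [|∂u|² + K(g) u + e^{2u} (-λ/2 + |β + ∂̄f|²)] dμ + C`. -/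
def donaldsonFunctional [MeasurableSpace X] (κ lam : ℝ)
    (g : OpenPartialHomeomorph X ℂ → ℂ → ℝ) (β : LocalCoeffs X) (C : ℝ)
    (u : X → ℝ) (f : LocalCoeffs X) : ℝ :=
  (∫ x, (atPoint (normSqPartial g u) x + atPoint (gaussCurvature g) x * u x +
      Real.exp (2 * u x) * (-lam / 2 + atPoint (normSqBeltrami κ g (β + dbar f)) x))
    ∂(areaMeasure g)) + C

/-- A smooth one-parameter family `(U t, F t)`, `t ∈ ℝ`, of pairs consisting of a real function
and a section of `T^{1,0}X`. -/
structure IsSmoothFamily (U : ℝ → X → ℝ) (F : ℝ → LocalCoeffs X) : Prop where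
  smooth_fun : ContMDiff (𝓘(ℝ, ℝ).prod 𝓘(ℝ, ℂ)) 𝓘(ℝ, ℝ) ∞ (fun p : ℝ × X => U p.1 p.2)
  transform : ∀ t, IsTensor 1 0 (F t)
  smooth_field : ∀ φ ∈ atlas ℂ X,
    ContDiffOn ℝ ∞ (fun p : ℝ × ℂ => F p.1 φ p.2) (Set.univ ×ˢ φ.target)

/-- `(u, f)` is a critical point of the restriction of the functional `D` to those smooth pairs
for which the constraint `S` holds: it is such a pair, and the derivative of `D` vanishes there
along every smooth family of such pairs. -/
structure IsCriticalPointOn (D : (X → ℝ) → LocalCoeffs X → ℝ)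
    (S : (X → ℝ) → LocalCoeffs X → Prop) (u : X → ℝ) (f : LocalCoeffs X) : Prop where
  smooth_fun : ContMDiff 𝓘(ℝ, ℂ) 𝓘(ℝ, ℝ) ∞ u
  smooth_field : IsSmoothTensor 1 0 f
  constraint : S u f
  critical : ∀ (U : ℝ → X → ℝ) (F : ℝ → LocalCoeffs X), IsSmoothFamily U F →
    U 0 = u → F 0 = f → (∀ t, S (U t) (F t)) → HasDerivAt (fun t => D (U t) (F t)) 0 0

/-- The metric `h` and the quadratic differential `α` solve the Gauss-Codazzi equations with
constant `λ`: `α` is holomorphic and `K(h) = λ - 2 |α|²_h`. -/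
structure SolvesGaussCodazzi (κ lam : ℝ) (h : OpenPartialHomeomorph X ℂ → ℂ → ℝ)
    (α : LocalCoeffs X) : Prop where
  metric : IsConformalMetric h
  codazzi : IsHolomorphicQuadraticDifferential α
  gauss : ∀ φ ∈ atlas ℂ X, ∀ z ∈ φ.target,
    gaussCurvature h φ z = lam - 2 * normSqQuad κ h α φ z

end

end

end CMC

namespace CMC

/-! Write `B = β + ∂̄f`. In the direction `(v, w)` the functional with constant `c` has first
variation `∫ [2 Re⟨∂u, ∂v⟩ + K(g) v + 2 e^{2u} v (c + |B|²) + e^{2u} 2 Re⟨B, ∂̄w⟩] dμ`, which is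
linear in `(v, w)` and depends on `c` only through `2c ∫ e^{2u} v dμ`, that is, `c` times the
derivative of the area (`hasDerivAt_integral_energyDensity`, `firstVariation_eq`).

The multiplier is found without an implicit function theorem. The constraint does not involve `f`,
so the variation in `w` vanishes outright. For `v`, adding a constant to `u` rescales the area, so
`u + tv - (1/2) log (A(t)/T)`, with `A(t)` the area of `u + tv`, stays on the constraint. Its
velocity is `v - m` with `m = (1/T) ∫ e^{2u} v dμ`. Criticality then says that the variation along
`v` is `m` times the variation along the constant `1`, and the latter divided by `T` is `λ`
(`exists_forall_firstVariation_eq_zero`). With `c = -λ/2` every first variation vanishes, which is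
the first claim.

For the second claim, test directions supported in one chart turn this into planar integral
identities. Since `u` and `f` are smooth, integration by parts and the fundamental lemma give
pointwise equations, with no regularity theory. Variation of `u` gives `g (K(g) + 2 e^{2u} (c +
|B|²)) = Δu`. With `e^{2u} g K(h) = g K(g) - Δu` and `|α|_h = |B|_g` this is the Gauss equation.
Variation of `f` pairs `α = e^{2u} g conj B` with `∂̄w`, so `∂̄α = 0`, which is the Codazzi
equation.

As all objects are families of coordinate expressions, the densities must also be shown independent
of the chart, and the area measure, a supremum over charts, must be identified with `g dx dy` in
each chart. -/

/-! ### Wirtinger calculus and the Laplacian under holomorphic maps -/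

theorem fderiv_comp_of_hasDerivAt {E : Type*} [NormedAddCommGroup E] [NormedSpace ℝ E]
    {h : ℂ → E} {τ : ℂ → ℂ} {τ' z : ℂ} (hτ : HasDerivAt τ τ' z)
    (hh : DifferentiableAt ℝ h (τ z)) (e : ℂ) :
    fderiv ℝ (fun w => h (τ w)) z e = fderiv ℝ h (τ z) (τ' * e) := by
  have h1 : HasFDerivAt τ _ z := hτ.hasFDerivAt.restrictScalars ℝ
  have h2 := (hh.hasFDerivAt.comp z h1).fderiv
  have h3 : fderiv ℝ (fun w => h (τ w)) z = _ := h2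
  rw [h3]
  simp [mul_comm]

theorem clm_mul_eq {E : Type*} [NormedAddCommGroup E] [NormedSpace ℝ E] (D : ℂ →L[ℝ] E) (a : ℂ) :
    D a = a.re • D 1 + a.im • D Complex.I := by
  rw [← map_smul, ← map_smul, ← map_add]
  congr 1
  apply Complex.ext <;> simp

/-- Multiplication by `τ'` before a real-linear map scales its complex-linear part by `τ'` and its
antilinear part by `conj τ'`. The two Wirtinger derivatives are these two parts. -/
theorem wirtinger_comp {h : ℂ → ℂ} {τ : ℂ → ℂ} {τ' z : ℂ} (hτ : HasDerivAt τ τ' z)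
    (hh : DifferentiableAt ℝ h (τ z)) :
    wirtinger (fun w => h (τ w)) z = τ' * wirtinger h (τ z) := by
  unfold wirtinger
  rw [fderiv_comp_of_hasDerivAt hτ hh, fderiv_comp_of_hasDerivAt hτ hh,
    clm_mul_eq _ (τ' * 1), clm_mul_eq _ (τ' * Complex.I)]
  generalize fderiv ℝ h (τ z) 1 = a
  generalize fderiv ℝ h (τ z) Complex.I = b
  apply Complex.ext <;> simp <;> ring

theorem wirtingerBar_comp {h : ℂ → ℂ} {τ : ℂ → ℂ} {τ' z : ℂ} (hτ : HasDerivAt τ τ' z)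
    (hh : DifferentiableAt ℝ h (τ z)) :
    wirtingerBar (fun w => h (τ w)) z = (starRingEnd ℂ) τ' * wirtingerBar h (τ z) := by
  unfold wirtingerBar
  rw [fderiv_comp_of_hasDerivAt hτ hh, fderiv_comp_of_hasDerivAt hτ hh,
    clm_mul_eq _ (τ' * 1), clm_mul_eq _ (τ' * Complex.I)]
  generalize fderiv ℝ h (τ z) 1 = a
  generalize fderiv ℝ h (τ z) Complex.I = b
  apply Complex.ext <;> simp <;> ring

theorem wirtingerBar_mul {h k : ℂ → ℂ} {z : ℂ} (hh : DifferentiableAt ℝ h z)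
    (hk : DifferentiableAt ℝ k z) :
    wirtingerBar (fun w => h w * k w) z = wirtingerBar h z * k z + h z * wirtingerBar k z := by
  unfold wirtingerBar
  rw [fderiv_fun_mul hh hk]
  simp
  ring

theorem wirtingerBar_eq_zero {h : ℂ → ℂ} {z : ℂ} (hh : DifferentiableAt ℂ h z) :
    wirtingerBar h z = 0 := by
  unfold wirtingerBar
  have h1 : HasFDerivAt h _ z := hh.hasDerivAt.hasFDerivAt.restrictScalars ℝ
  rw [h1.fderiv]
  simp [← mul_assoc]

theorem differentiableAt_of_wirtingerBar_eq_zero {h : ℂ → ℂ} {z : ℂ}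
    (hh : DifferentiableAt ℝ h z) (h0 : wirtingerBar h z = 0) : DifferentiableAt ℂ h z := by
  rw [differentiableAt_complex_iff_differentiableAt_real]
  refine ⟨hh, ?_⟩
  have h1 : fderiv ℝ h z 1 + Complex.I * fderiv ℝ h z Complex.I = 0 := by
    simpa [wirtingerBar] using h0
  -- Multiplying by `I` puts the equation in the Cauchy–Riemann form `h_y = I h_x`.
  have h2 : Complex.I * (fderiv ℝ h z 1 + Complex.I * fderiv ℝ h z Complex.I) = 0 := by
    rw [h1, mul_zero]
  rw [mul_add, ← mul_assoc, Complex.I_mul_I] at h2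
  simp only [smul_eq_mul]
  linear_combination -h2

theorem laplacian_eq_fderiv (f : ℂ → ℝ) (z : ℂ) :
    Laplacian.laplacian f z = fderiv ℝ (fderiv ℝ f) z 1 1 +
      fderiv ℝ (fderiv ℝ f) z Complex.I Complex.I := by
  rw [InnerProductSpace.laplacian_eq_iteratedFDeriv_complexPlane]
  simp [iteratedFDeriv_two_apply]

/-- The second derivative of `h ∘ τ` along `e` is `D²h(τ'e, τ'e) + Dh(τ'' e²)`. Summing over `e = 1,
I` cancels the `τ''` terms because `1² + I² = 0`, and `τ'` acts as a rotation scaled by `‖τ'‖`, so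
the trace of `D²h` is multiplied by `‖τ'‖²`. -/
theorem laplacian_comp_of_analyticAt {h : ℂ → ℝ} {τ : ℂ → ℂ} {z : ℂ} (hτ : AnalyticAt ℂ τ z)
    (hh : ContDiffAt ℝ 2 h (τ z)) :
    Laplacian.laplacian (fun w => h (τ w)) z =
      ‖deriv τ z‖ ^ 2 * Laplacian.laplacian h (τ z) := by
  have hd : DifferentiableAt ℝ (fderiv ℝ h) (τ z) :=
    (hh.fderiv_right (m := 1) (by norm_num)).differentiableAt (by norm_num)
  have hτ1 : HasFDerivAt τ _ z := hτ.differentiableAt.hasDerivAt.hasFDerivAt.restrictScalars ℝ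
  have hτ2 : HasFDerivAt (deriv τ) _ z :=
    hτ.deriv.differentiableAt.hasDerivAt.hasFDerivAt.restrictScalars ℝ
  have hev : ∀ᶠ w in nhds z, AnalyticAt ℂ τ w ∧ DifferentiableAt ℝ h (τ w) := by
    refine (hτ.eventually_analyticAt).and ?_
    refine hτ.continuousAt.eventually ?_
    filter_upwards [hh.eventually (by simp)] with w hw
    exact hw.differentiableAt (by norm_num)
  have hfd : Filter.EventuallyEq (nhds z) (fderiv ℝ (fun w => h (τ w)))
      (fun w => (fderiv ℝ h (τ w)).comp (ContinuousLinearMap.mul ℝ ℂ (deriv τ w))) := by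
    filter_upwards [hev] with w hw
    ext e
    simp [fderiv_comp_of_hasDerivAt hw.1.differentiableAt.hasDerivAt hw.2]
  have hmul : HasFDerivAt (fun w => ContinuousLinearMap.mul ℝ ℂ (deriv τ w)) _ z :=
    (ContinuousLinearMap.mul ℝ ℂ).hasFDerivAt.comp z hτ2
  have hcomp : HasFDerivAt (fun w => fderiv ℝ h (τ w)) _ z := hd.hasFDerivAt.comp z hτ1
  have key : ∀ e : ℂ, fderiv ℝ (fderiv ℝ (fun w => h (τ w))) z e e =
      fderiv ℝ (fderiv ℝ h) (τ z) (deriv τ z * e) (deriv τ z * e) +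
        fderiv ℝ h (τ z) (deriv (deriv τ) z * e * e) := by
    intro e
    rw [hfd.fderiv_eq, (hcomp.clm_comp hmul).fderiv]
    simp [mul_comm, add_comm]
  rw [laplacian_eq_fderiv, laplacian_eq_fderiv, key, key]
  have e1 : deriv (deriv τ) z * Complex.I * Complex.I = -(deriv (deriv τ) z * 1 * 1) := by
    rw [mul_assoc, Complex.I_mul_I]; ring
  rw [e1, map_neg, ← Complex.normSq_eq_norm_sq, Complex.normSq_apply]
  generalize deriv τ z = a
  generalize fderiv ℝ (fderiv ℝ h) (τ z) = B
  rw [clm_mul_eq B (a * 1), clm_mul_eq B (a * Complex.I)]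
  simp only [add_apply, smul_apply]
  rw [clm_mul_eq (B 1) (a * 1), clm_mul_eq (B Complex.I) (a * 1),
    clm_mul_eq (B 1) (a * Complex.I), clm_mul_eq (B Complex.I) (a * Complex.I)]
  simp
  ring

/-! ### Integration by parts and the fundamental lemma in plane domains -/

theorem integrable_of_continuousOn_of_eq_zero {A B : Type*} [NormedAddCommGroup A]
    [Zero B] [TopologicalSpace B] {Ω : Set ℂ} {ρ : ℂ → B} (hc : HasCompactSupport ρ)
    (hs : tsupport ρ ⊆ Ω) {F : ℂ → A} (hF : ContinuousOn F Ω)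
    (hF0 : ∀ z, z ∉ tsupport ρ → F z = 0) : Integrable F := by
  have : IntegrableOn F (tsupport ρ) := (hF.mono hs).integrableOn_compact hc
  refine (integrableOn_iff_integrable_of_support_subset ?_).1 this
  intro z hzF
  by_contra hcon
  exact hzF (hF0 z hcon)

/-- The integral of a directional derivative of a compactly supported function vanishes. -/
theorem integral_fderiv_mul_add_eq_zero {A : Type*} [NormedCommRing A] [NormedAlgebra ℝ A]
    {Ω : Set ℂ} (hΩ : IsOpen Ω) {h ρ : ℂ → A} (hh : ContDiffOn ℝ 1 h Ω) (hρ : ContDiff ℝ 1 ρ)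
    (hc : HasCompactSupport ρ) (hs : tsupport ρ ⊆ Ω) (e : ℂ) :
    ∫ z in Ω, (fderiv ℝ h z e * ρ z + h z * fderiv ℝ ρ z e) = 0 ∧
      IntegrableOn (fun z => fderiv ℝ h z e * ρ z) Ω ∧
      IntegrableOn (fun z => h z * fderiv ℝ ρ z e) Ω := by
  have hz : ∀ z, z ∉ tsupport ρ → ρ z = 0 := fun z hz => image_eq_zero_of_notMem_tsupport hz
  have hz' : ∀ z, z ∉ tsupport ρ → fderiv ℝ ρ z = 0 := fun z hz =>
    image_eq_zero_of_notMem_tsupport (fun h' => hz (tsupport_fderiv_subset ℝ h'))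
  have hext : ∀ F : ℂ → A, ContinuousOn F Ω → (∀ z, z ∉ tsupport ρ → F z = 0) → Integrable F :=
    fun F hF hF0 => integrable_of_continuousOn_of_eq_zero hc hs hF hF0
  have hi1 : Integrable (fun z => fderiv ℝ h z e * ρ z) := by
    refine hext _ ?_ (fun z h1 => by simp [hz z h1])
    exact (((hh.continuousOn_fderiv_of_isOpen hΩ le_rfl).clm_apply continuousOn_const)).mul
      hρ.continuous.continuousOn
  have hi2 : Integrable (fun z => h z * fderiv ℝ ρ z e) := by
    refine hext _ ?_ (fun z h1 => by simp [hz' z h1])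
    exact hh.continuousOn.mul
      (((hρ.continuous_fderiv (by norm_num)).clm_apply continuous_const).continuousOn)
  refine ⟨?_, hi1.integrableOn, hi2.integrableOn⟩
  have hi3 : Integrable (fun z => h z * ρ z) :=
    hext _ (hh.continuousOn.mul hρ.continuous.continuousOn) (fun z h1 => by simp [hz z h1])
  -- `h` is controlled only on `Ω`, but off the support of `ρ` the product is locally zero, so it is
  -- differentiable on the whole plane.
  have hder : ∀ z, HasFDerivAt (fun z => h z * ρ z) (h z • fderiv ℝ ρ z + ρ z • fderiv ℝ h z) z := by
    intro z
    by_cases hzs : z ∈ tsupport ρ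
    · have h1 : DifferentiableAt ℝ h z :=
        (hh.contDiffAt (hΩ.mem_nhds (hs hzs))).differentiableAt (by norm_num)
      exact h1.hasFDerivAt.mul ((hρ.differentiable (by norm_num)).differentiableAt.hasFDerivAt)
    · have h0 : h z • fderiv ℝ ρ z + ρ z • fderiv ℝ h z = 0 := by
        ext; simp [hz z hzs, hz' z hzs]
      rw [h0]
      have : (fun z => h z * ρ z) =ᶠ[nhds z] fun _ => 0 := by
        filter_upwards [(isClosed_tsupport ρ).isOpen_compl.mem_nhds hzs] with w hw
        simp [hz w hw]
      exact (hasFDerivAt_const (0 : A) z).congr_of_eventuallyEq this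
  have heq : ∀ z, (h z • fderiv ℝ ρ z + ρ z • fderiv ℝ h z) e =
      fderiv ℝ h z e * ρ z + h z * fderiv ℝ ρ z e := by
    intro z
    simp [mul_comm, add_comm]
  have hint : Integrable (fun z => (h z • fderiv ℝ ρ z + ρ z • fderiv ℝ h z) e) := by
    simp_rw [heq]; exact hi1.add hi2
  -- Integration by parts against the constant `1`: only the products have to be integrable, and the
  -- derivative of `1` is zero.
  have := integral_bilinear_hasLineDerivAt_right_eq_neg_left_of_integrable (μ := volume)
    (f := fun _ : ℂ => (1 : ℝ)) (f' := fun _ => (0 : ℝ)) (g := fun z => h z * ρ z)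
    (g' := fun z => (h z • fderiv ℝ ρ z + ρ z • fderiv ℝ h z) e) (v := e)
    (B := ContinuousLinearMap.lsmul ℝ ℝ) (by simp) (by simpa using hint) (by simpa using hi3)
    (fun z _ => by simpa using (hasFDerivAt_const (1 : ℝ) z).hasLineDerivAt e)
    (fun z _ => (hder z).hasLineDerivAt e)
  simp only [ContinuousLinearMap.lsmul_apply, one_smul, zero_smul, integral_zero, neg_zero] at this
  rw [← this]
  simp_rw [heq]
  refine setIntegral_eq_integral_of_forall_compl_eq_zero (fun z hzΩ => ?_)
  have : z ∉ tsupport ρ := fun h' => hzΩ (hs h')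
  simp [hz z this, hz' z this]

/-- The fundamental lemma of the calculus of variations for continuous functions. -/
theorem eq_zero_of_forall_integral_mul_eq_zero {Ω : Set ℂ} (hΩ : IsOpen Ω) {H : ℂ → ℝ}
    (hH : ContinuousOn H Ω)
    (h : ∀ ρ : ℂ → ℝ, ContDiff ℝ ∞ ρ → HasCompactSupport ρ → tsupport ρ ⊆ Ω →
      ∫ z in Ω, H z * ρ z = 0) : ∀ z ∈ Ω, H z = 0 := by
  have h1 : ∀ᵐ z ∂(volume : Measure ℂ), z ∈ Ω → H z = 0 := by
    refine hΩ.ae_eq_zero_of_integral_contDiff_smul_eq_zero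
      (hH.locallyIntegrableOn hΩ.measurableSet) ?_
    intro ρ h1 h2 h3
    rw [← h ρ h1 h2 h3]
    rw [setIntegral_eq_integral_of_forall_compl_eq_zero]
    · simp_rw [smul_eq_mul, mul_comm]
    · intro z hz
      rw [image_eq_zero_of_notMem_tsupport (fun h' => hz (h3 h')), mul_zero]
  exact Measure.eqOn_open_of_ae_eq ((ae_restrict_iff' hΩ.measurableSet).2 h1) hΩ hH
    continuousOn_const

/-! ### Coordinate changes and smoothness in charts -/

theorem eventually_mem_overlap {X : Type*} [TopologicalSpace X]
    {φ ψ : OpenPartialHomeomorph X ℂ} {x : X}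
    (hx : x ∈ φ.source ∩ ψ.source) :
    ∀ᶠ w in nhds (φ x), w ∈ φ.target ∧ φ.symm w ∈ ψ.source := by
  have h := (φ.symm ≫ₕ ψ).open_source.mem_nhds (x := φ x)
    (by simp [hx.1, hx.2])
  filter_upwards [h] with w hw
  simpa [OpenPartialHomeomorph.trans_source] using hw

section
variable {X : Type*} [TopologicalSpace X] [ChartedSpace ℂ X]

/-- The coordinate expressions `s φ` define one function on `X`. -/
def IsScalar (s : OpenPartialHomeomorph X ℂ → ℂ → ℝ) : Prop :=
  ∀ φ ∈ atlas ℂ X, ∀ ψ ∈ atlas ℂ X, ∀ x ∈ φ.source ∩ ψ.source, s φ (φ x) = s ψ (ψ x)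

theorem atPoint_eq {s : OpenPartialHomeomorph X ℂ → ℂ → ℝ} (hs : IsScalar s)
    {φ : OpenPartialHomeomorph X ℂ} (hφ : φ ∈ atlas ℂ X) {x : X} (hx : x ∈ φ.source) :
    atPoint s x = s φ (φ x) :=
  hs _ (chart_mem_atlas ℂ x) _ hφ x ⟨mem_chart_source ℂ x, hx⟩

theorem continuous_atPoint {s : OpenPartialHomeomorph X ℂ → ℂ → ℝ} (hs : IsScalar s)
    (hc : ∀ φ ∈ atlas ℂ X, ContinuousOn (s φ) φ.target) : Continuous (atPoint s) := by
  rw [continuous_iff_continuousAt]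
  intro x
  have hφ := chart_mem_atlas ℂ x
  have hx := mem_chart_source ℂ x
  have h1 : ContinuousAt (fun y => s (chartAt ℂ x) (chartAt ℂ x y)) x :=
    ContinuousAt.comp (f := chartAt ℂ x) (g := s (chartAt ℂ x))
      ((hc _ hφ).continuousAt ((chartAt ℂ x).open_target.mem_nhds ((chartAt ℂ x).map_source hx)))
      ((chartAt ℂ x).continuousAt hx)
  refine h1.congr ?_
  filter_upwards [(chartAt ℂ x).open_source.mem_nhds hx] with y hy
  exact (atPoint_eq hs hφ hy).symm

theorem IsTensor.add {p q : ℤ} {s t : LocalCoeffs X} (hs : IsTensor p q s) (ht : IsTensor p q t) :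
    IsTensor p q (s + t) := by
  intro φ hφ ψ hψ x hx
  simp only [Pi.add_apply, hs φ hφ ψ hψ x hx, ht φ hφ ψ hψ x hx]
  ring

variable [IsManifold 𝓘(ℂ) ω X]

theorem contDiffOn_transition {φ ψ : OpenPartialHomeomorph X ℂ} (hφ : φ ∈ atlas ℂ X)
    (hψ : ψ ∈ atlas ℂ X) : ContDiffOn ℂ ω (ψ ∘ φ.symm) (φ.symm ≫ₕ ψ).source := by
  have h := HasGroupoid.compatible (G := contDiffGroupoid ω 𝓘(ℂ)) hφ hψ
  rw [contDiffGroupoid, mem_groupoid_of_pregroupoid] at h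
  have h1 := h.1
  simpa [contDiffPregroupoid, Function.comp_def] using h1

theorem analyticAt_transition {φ ψ : OpenPartialHomeomorph X ℂ} (hφ : φ ∈ atlas ℂ X)
    (hψ : ψ ∈ atlas ℂ X) {x : X} (hx : x ∈ φ.source ∩ ψ.source) :
    AnalyticAt ℂ (ψ ∘ φ.symm) (φ x) := by
  have h := contDiffOn_transition hφ hψ
  refine ContDiffAt.analyticAt (h.contDiffAt ((φ.symm ≫ₕ ψ).open_source.mem_nhds ?_))
  simp [hx.1, hx.2]

theorem hasDerivAt_transition {φ ψ : OpenPartialHomeomorph X ℂ} (hφ : φ ∈ atlas ℂ X)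
    (hψ : ψ ∈ atlas ℂ X) {x : X} (hx : x ∈ φ.source ∩ ψ.source) :
    HasDerivAt (ψ ∘ φ.symm) (deriv (ψ ∘ φ.symm) (φ x)) (φ x) :=
  (analyticAt_transition hφ hψ hx).differentiableAt.hasDerivAt

/-- The cocycle rule. It makes transition derivatives invertible and gives the transformation law of
`bumpField`. -/
theorem deriv_transition_comp {φ ψ χ : OpenPartialHomeomorph X ℂ} (hφ : φ ∈ atlas ℂ X)
    (hψ : ψ ∈ atlas ℂ X) (hχ : χ ∈ atlas ℂ X) {x : X} (hx : x ∈ φ.source) (hx' : x ∈ ψ.source)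
    (hx'' : x ∈ χ.source) :
    deriv (χ ∘ φ.symm) (φ x) = deriv (χ ∘ ψ.symm) (ψ x) * deriv (ψ ∘ φ.symm) (φ x) := by
  have h1 := hasDerivAt_transition hφ hψ ⟨hx, hx'⟩
  have h2 := hasDerivAt_transition hψ hχ ⟨hx', hx''⟩
  have h3 : HasDerivAt ((χ ∘ ψ.symm) ∘ (ψ ∘ φ.symm)) _ (φ x) :=
    HasDerivAt.comp (φ x) (by rw [Function.comp_apply, φ.left_inv hx]; exact h2) h1
  have h4 := h3.congr_of_eventuallyEq (f₁ := χ ∘ φ.symm) (by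
    filter_upwards [eventually_mem_overlap (φ := φ) (ψ := ψ) ⟨hx, hx'⟩] with w hw
    simp [ψ.left_inv hw.2])
  exact h4.deriv

theorem deriv_transition_ne_zero {φ ψ : OpenPartialHomeomorph X ℂ} (hφ : φ ∈ atlas ℂ X)
    (hψ : ψ ∈ atlas ℂ X) {x : X} (hx : x ∈ φ.source ∩ ψ.source) :
    deriv (ψ ∘ φ.symm) (φ x) ≠ 0 := by
  have h := deriv_transition_comp hφ hψ hφ hx.1 hx.2 hx.1
  have h1 : deriv (φ ∘ φ.symm) (φ x) = 1 := by
    have : (φ ∘ φ.symm) =ᶠ[nhds (φ x)] id := by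
      filter_upwards [φ.open_target.mem_nhds (φ.map_source hx.1)] with w hw
      simp [φ.right_inv hw]
    rw [this.deriv_eq]
    simp
  intro h0
  rw [h1, h0, mul_zero] at h
  exact one_ne_zero h

/-- The underlying real surface. -/
theorem isManifold_real : IsManifold 𝓘(ℝ, ℂ) ∞ X := by
  refine isManifold_of_contDiffOn _ _ _ (fun φ ψ hφ hψ => ?_)
  have h := ((contDiffOn_transition hφ hψ).restrict_scalars ℝ).of_le (m := ∞) le_top
  simpa [Function.comp_def] using h

theorem contDiffOn_comp_symm {u : X → ℝ} (hu : ContMDiff 𝓘(ℝ, ℂ) 𝓘(ℝ, ℝ) ∞ u)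
    {φ : OpenPartialHomeomorph X ℂ} (hφ : φ ∈ atlas ℂ X) :
    ContDiffOn ℝ ∞ (fun z => u (φ.symm z)) φ.target := by
  have := isManifold_real (X := X)
  rw [← contMDiffOn_iff_contDiffOn]
  exact hu.comp_contMDiffOn (contMDiffOn_symm_of_mem_maximalAtlas
    (IsManifold.subset_maximalAtlas hφ))

theorem contDiffOn_family_comp_symm {U : ℝ → X → ℝ}
    (hU : ContMDiff (𝓘(ℝ, ℝ).prod 𝓘(ℝ, ℂ)) 𝓘(ℝ, ℝ) ∞ (fun p : ℝ × X => U p.1 p.2))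
    {φ : OpenPartialHomeomorph X ℂ} (hφ : φ ∈ atlas ℂ X) :
    ContDiffOn ℝ ∞ (fun p : ℝ × ℂ => U p.1 (φ.symm p.2)) (Set.univ ×ˢ φ.target) := by
  have := isManifold_real (X := X)
  rw [← contMDiffOn_iff_contDiffOn]
  have h1 : ContMDiffOn 𝓘(ℝ, ℝ × ℂ) 𝓘(ℝ, ℂ) ∞ (fun p : ℝ × ℂ => φ.symm p.2)
      (Set.univ ×ˢ φ.target) :=
    (contMDiffOn_symm_of_mem_maximalAtlas (IsManifold.subset_maximalAtlas hφ)).comp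
      contDiff_snd.contMDiff.contMDiffOn (fun p hp => hp.2)
  exact hU.comp_contMDiffOn ((contDiff_fst.contMDiff.contMDiffOn).prodMk h1)

theorem contMDiff_of_forall_contDiffOn {v : X → ℝ}
    (hv : ∀ φ ∈ atlas ℂ X, ContDiffOn ℝ ∞ (fun z => v (φ.symm z)) φ.target) :
    ContMDiff 𝓘(ℝ, ℂ) 𝓘(ℝ, ℝ) ∞ v := by
  have := isManifold_real (X := X)
  intro x
  have hx := mem_chart_source ℂ x
  have h1 := (hv _ (chart_mem_atlas ℂ x)).contDiffAt
    ((chartAt ℂ x).open_target.mem_nhds ((chartAt ℂ x).map_source hx))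
  have h2 : ContMDiffAt 𝓘(ℝ, ℂ) 𝓘(ℝ, ℂ) ∞ (chartAt ℂ x) x :=
    (contMDiffOn_of_mem_maximalAtlas (I := 𝓘(ℝ, ℂ)) (n := ∞)
      (IsManifold.subset_maximalAtlas (chart_mem_atlas ℂ x))).contMDiffAt
      ((chartAt ℂ x).open_source.mem_nhds hx)
  refine (ContMDiffAt.comp x (I' := 𝓘(ℝ, ℂ)) h1.contMDiffAt h2).congr_of_eventuallyEq ?_
  filter_upwards [(chartAt ℂ x).open_source.mem_nhds hx] with y hy
  simp [(chartAt ℂ x).left_inv hy]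

/-! ### Tensor laws and invariance -/

theorem wirtinger_transition {u : X → ℝ} (hu : ContMDiff 𝓘(ℝ, ℂ) 𝓘(ℝ, ℝ) ∞ u)
    {φ ψ : OpenPartialHomeomorph X ℂ} (hφ : φ ∈ atlas ℂ X)
    (hψ : ψ ∈ atlas ℂ X) {x : X} (hx : x ∈ φ.source ∩ ψ.source) :
    wirtinger (fun w => (u (φ.symm w) : ℂ)) (φ x) =
      deriv (ψ ∘ φ.symm) (φ x) * wirtinger (fun w => (u (ψ.symm w) : ℂ)) (ψ x) := by
  have hd : DifferentiableAt ℝ (fun w => (u (ψ.symm w) : ℂ)) ((ψ ∘ φ.symm) (φ x)) := by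
    have h1 := (contDiffOn_comp_symm hu hψ).contDiffAt
      (ψ.open_target.mem_nhds (ψ.map_source hx.2))
    rw [Function.comp_apply, φ.left_inv hx.1]
    exact Complex.ofRealCLM.differentiableAt.comp (ψ x) (h1.differentiableAt (by simp))
  have h2 := wirtinger_comp (hasDerivAt_transition hφ hψ hx) hd
  rw [Function.comp_apply, φ.left_inv hx.1] at h2
  rw [← h2]
  have h3 : (fun w => (u (φ.symm w) : ℂ)) =ᶠ[nhds (φ x)]
      (fun w => (u (ψ.symm ((ψ ∘ φ.symm) w)) : ℂ)) := by
    filter_upwards [eventually_mem_overlap hx] with w hw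
    simp [ψ.left_inv hw.2]
  unfold wirtinger
  rw [h3.fderiv_eq]

/-- On the overlap `f^ψ ∘ τ = τ' f^φ`. Since `τ'` is holomorphic, `∂̄` passes through it on the
right, while the chain rule produces `conj τ'` on the left. -/
theorem isTensor_dbar {f : LocalCoeffs X} (hf : IsSmoothTensor 1 0 f) :
    IsTensor 1 (-1) (dbar f) := by
  intro φ hφ ψ hψ x hx
  have ha := analyticAt_transition hφ hψ hx
  have hd : DifferentiableAt ℝ (f ψ) ((ψ ∘ φ.symm) (φ x)) := by
    rw [Function.comp_apply, φ.left_inv hx.1]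
    exact ((hf.smooth ψ hψ).contDiffAt
      (ψ.open_target.mem_nhds (ψ.map_source hx.2))).differentiableAt (by simp)
  have h1 := wirtingerBar_comp (hasDerivAt_transition hφ hψ hx) hd
  have hfφ : DifferentiableAt ℝ (f φ) (φ x) := ((hf.smooth φ hφ).contDiffAt
      (φ.open_target.mem_nhds (φ.map_source hx.1))).differentiableAt (by simp)
  have h2 := wirtingerBar_mul (ha.deriv.differentiableAt.restrictScalars ℝ) hfφ
  rw [wirtingerBar_eq_zero ha.deriv.differentiableAt, zero_mul, zero_add] at h2
  have h3 : (fun w => f ψ ((ψ ∘ φ.symm) w)) =ᶠ[nhds (φ x)]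
      (fun w => deriv (ψ ∘ φ.symm) w * f φ w) := by
    filter_upwards [eventually_mem_overlap hx] with w hw
    have := hf.transform φ hφ ψ hψ (φ.symm w) ⟨φ.map_target hw.1, hw.2⟩
    simpa [φ.right_inv hw.1] using this
  have h4 : wirtingerBar (fun w => f ψ ((ψ ∘ φ.symm) w)) (φ x) =
      wirtingerBar (fun w => deriv (ψ ∘ φ.symm) w * f φ w) (φ x) := by
    unfold wirtingerBar
    rw [h3.fderiv_eq]
  rw [h1, h2, Function.comp_apply, φ.left_inv hx.1] at h4
  have hne : (starRingEnd ℂ) (deriv (ψ ∘ φ.symm) (φ x)) ≠ 0 := by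
    simpa using deriv_transition_ne_zero hφ hψ hx
  simp only [dbar, zpow_one, zpow_neg]
  field_simp
  linear_combination h4

/-- The logarithms of the two local metrics differ by `2 log ‖τ'‖`, which is harmonic. The factor
`‖τ'‖²` gained by the Laplacian is the one gained by the metric in the denominator. -/
theorem isScalar_gaussCurvature {g : OpenPartialHomeomorph X ℂ → ℂ → ℝ}
    (hg : IsConformalMetric g) : IsScalar (gaussCurvature g) := by
  intro φ hφ ψ hψ x hx
  have ha := analyticAt_transition hφ hψ hx
  have hne := deriv_transition_ne_zero hφ hψ hx
  have hxt : ψ x ∈ ψ.target := ψ.map_source hx.2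
  have hτx : (ψ ∘ φ.symm) (φ x) = ψ x := by simp [φ.left_inv hx.1]
  have hlog : ContDiffAt ℝ 2 (fun w => Real.log (g ψ w)) ((ψ ∘ φ.symm) (φ x)) := by
    rw [hτx]
    exact (((hg.smooth ψ hψ).contDiffAt (ψ.open_target.mem_nhds hxt)).of_le
      (WithTop.coe_le_coe.2 (le_top (a := (2 : ℕ∞))))).log (hg.pos ψ hψ _ hxt).ne'
  have hharm := ha.deriv.harmonicAt_log_norm hne
  have h1 : (fun w => Real.log (g φ w)) =ᶠ[nhds (φ x)]
      ((2 : ℝ) • (fun w => Real.log ‖deriv (ψ ∘ φ.symm) w‖)) +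
        (fun w => Real.log (g ψ ((ψ ∘ φ.symm) w))) := by
    filter_upwards [eventually_mem_overlap hx] with w hw
    have hy : φ.symm w ∈ φ.source ∩ ψ.source := ⟨φ.map_target hw.1, hw.2⟩
    have h2 := hg.transform φ hφ ψ hψ _ hy
    have hne' := deriv_transition_ne_zero hφ hψ hy
    rw [φ.right_inv hw.1] at h2 hne'
    simp only [Pi.add_apply, Pi.smul_apply, Function.comp_apply, smul_eq_mul]
    rw [h2, Real.log_mul (by simpa using hne') (hg.pos ψ hψ _ (ψ.map_source hw.2)).ne',
      Real.log_pow]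
    simp
  have hcomp : ContDiffAt ℝ 2 (fun w => Real.log (g ψ ((ψ ∘ φ.symm) w))) (φ x) :=
    hlog.comp (φ x) (ha.contDiffAt.restrict_scalars ℝ)
  have h3 : Laplacian.laplacian (fun w => Real.log (g φ w)) (φ x) =
      ‖deriv (ψ ∘ φ.symm) (φ x)‖ ^ 2 *
        Laplacian.laplacian (fun w => Real.log (g ψ w)) (ψ x) := by
    rw [(InnerProductSpace.laplacian_congr_nhds h1).eq_of_nhds,
      ContDiffAt.laplacian_add
        (f₁ := (2 : ℝ) • (fun w => Real.log ‖deriv (ψ ∘ φ.symm) w‖)) (hharm.1.const_smul (2 : ℝ)) hcomp,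
      InnerProductSpace.laplacian_smul _ hharm.1, laplacian_comp_of_analyticAt ha hlog, hτx]
    rw [hharm.2.eq_of_nhds]
    simp
  unfold gaussCurvature
  rw [h3, hg.transform φ hφ ψ hψ x hx]
  have hpos := (hg.pos ψ hψ _ hxt).ne'
  have hn : ‖deriv (ψ ∘ φ.symm) (φ x)‖ ≠ 0 := by simpa using hne
  field_simp

end

/-! ### Polarised norms and their invariance -/

section
variable {X : Type*} [TopologicalSpace X]

/-- The polarisation `2 Re ⟨∂u, ∂v⟩` of `normSqPartial`. -/
noncomputable def crossPartial (g : OpenPartialHomeomorph X ℂ → ℂ → ℝ) (u v : X → ℝ)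
    (φ : OpenPartialHomeomorph X ℂ) (z : ℂ) : ℝ :=
  4 / g φ z * ((starRingEnd ℂ) (wirtinger (fun w => (u (φ.symm w) : ℂ)) z) *
    wirtinger (fun w => (v (φ.symm w) : ℂ)) z).re

/-- The polarisation `2 Re ⟨b, b'⟩` of `normSqBeltrami`. -/
noncomputable def crossBeltrami (κ : ℝ) (b b' : LocalCoeffs X)
    (φ : OpenPartialHomeomorph X ℂ) (z : ℂ) : ℝ :=
  2 * κ * ((starRingEnd ℂ) (b φ z) * b' φ z).re

theorem normSqPartial_eq (g : OpenPartialHomeomorph X ℂ → ℂ → ℝ) (u : X → ℝ)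
    (φ : OpenPartialHomeomorph X ℂ) (z : ℂ) :
    normSqPartial g u φ z = 1 / 2 * crossPartial g u u φ z := by
  unfold normSqPartial crossPartial
  rw [mul_comm ((starRingEnd ℂ) _), Complex.mul_conj, Complex.ofReal_re,
    Complex.normSq_eq_norm_sq]
  ring

variable [ChartedSpace ℂ X]

/-- The factor `g` in the dual cancels the `g⁻²` in the norm: `|b ∂_z ⊗ dz̄|²` does not see the
conformal factor. This is why `crossBeltrami` carries no metric. -/
theorem normSqBeltrami_eq (κ : ℝ) {g : OpenPartialHomeomorph X ℂ → ℂ → ℝ}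
    (hg : IsConformalMetric g) (b : LocalCoeffs X) {φ : OpenPartialHomeomorph X ℂ}
    (hφ : φ ∈ atlas ℂ X) {z : ℂ} (hz : z ∈ φ.target) :
    normSqBeltrami κ g b φ z = κ * ‖b φ z‖ ^ 2 := by
  have hp := (hg.pos φ hφ z hz).ne'
  simp only [normSqBeltrami, normSqQuad, conjDual, norm_mul, Complex.norm_real, RCLike.norm_conj,
    mul_pow, Real.norm_eq_abs, sq_abs]
  field_simp

theorem normSqBeltrami_eq_cross (κ : ℝ) {g : OpenPartialHomeomorph X ℂ → ℂ → ℝ}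
    (hg : IsConformalMetric g) (b : LocalCoeffs X) {φ : OpenPartialHomeomorph X ℂ}
    (hφ : φ ∈ atlas ℂ X) {z : ℂ} (hz : z ∈ φ.target) :
    normSqBeltrami κ g b φ z = 1 / 2 * crossBeltrami κ b b φ z := by
  rw [normSqBeltrami_eq κ hg b hφ hz, crossBeltrami, mul_comm ((starRingEnd ℂ) _),
    Complex.mul_conj, Complex.ofReal_re, Complex.normSq_eq_norm_sq]
  ring

variable [IsManifold 𝓘(ℂ) ω X]

theorem isScalar_crossPartial {g : OpenPartialHomeomorph X ℂ → ℂ → ℝ}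
    (hg : IsConformalMetric g) {u v : X → ℝ} (hu : ContMDiff 𝓘(ℝ, ℂ) 𝓘(ℝ, ℝ) ∞ u)
    (hv : ContMDiff 𝓘(ℝ, ℂ) 𝓘(ℝ, ℝ) ∞ v) : IsScalar (crossPartial g u v) := by
  intro φ hφ ψ hψ x hx
  unfold crossPartial
  rw [wirtinger_transition hu hφ hψ hx, wirtinger_transition hv hφ hψ hx,
    hg.transform φ hφ ψ hψ x hx]
  have hn : ‖deriv (ψ ∘ φ.symm) (φ x)‖ ≠ 0 := by simpa using deriv_transition_ne_zero hφ hψ hx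
  have hp := (hg.pos ψ hψ _ (ψ.map_source hx.2)).ne'
  generalize wirtinger (fun w => (u (ψ.symm w) : ℂ)) (ψ x) = a
  generalize wirtinger (fun w => (v (ψ.symm w) : ℂ)) (ψ x) = b
  generalize deriv (ψ ∘ φ.symm) (φ x) = τ at *
  have : (starRingEnd ℂ) (τ * a) * (τ * b) = ((‖τ‖ ^ 2 : ℝ) : ℂ) * ((starRingEnd ℂ) a * b) := by
    rw [← Complex.normSq_eq_norm_sq, Complex.normSq_eq_conj_mul_self, map_mul]
    ring
  rw [this, Complex.re_ofReal_mul]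
  field_simp

/-- The transition factor `τ / conj τ` of a Beltrami tensor has modulus one. -/
theorem isScalar_crossBeltrami (κ : ℝ) {b b' : LocalCoeffs X} (hb : IsTensor 1 (-1) b)
    (hb' : IsTensor 1 (-1) b') : IsScalar (crossBeltrami κ b b') := by
  intro φ hφ ψ hψ x hx
  unfold crossBeltrami
  rw [hb φ hφ ψ hψ x hx, hb' φ hφ ψ hψ x hx]
  have hn := deriv_transition_ne_zero hφ hψ hx
  generalize deriv (ψ ∘ φ.symm) (φ x) = τ at *
  have hn' : (starRingEnd ℂ) τ ≠ 0 := by simpa using hn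
  congr 2
  simp only [map_mul, zpow_one, zpow_neg, map_inv₀, Complex.conj_conj]
  field_simp

end

/-! ### The area measure in charts -/

section
variable {X : Type*} [TopologicalSpace X]

/-- The image on `X` of the area measure `g φ z * dx dy` on the target of the coordinate `φ`. -/
noncomputable def chartMeasure [MeasurableSpace X] (g : OpenPartialHomeomorph X ℂ → ℂ → ℝ)
    (φ : OpenPartialHomeomorph X ℂ) : Measure X :=
  Measure.map φ.symm ((volume.restrict φ.target).withDensity (fun z => ENNReal.ofReal (g φ z)))

theorem measurableSet_target_inter_preimage [MeasurableSpace X] [BorelSpace X]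
    (φ : OpenPartialHomeomorph X ℂ) {A : Set X} (hA : MeasurableSet A) :
    MeasurableSet (φ.target ∩ φ.symm ⁻¹' A) := by
  have h1 : Measurable (φ.target.domRestrict φ.symm) :=
    (continuousOn_iff_continuous_domRestrict.1 φ.continuousOn_symm).measurable
  have h2 := (MeasurableEmbedding.subtype_coe φ.open_target.measurableSet).measurableSet_image.2
    (h1 hA)
  convert h2 using 1
  ext z
  simp [Set.domRestrict, and_comm]

theorem aemeasurable_symm [MeasurableSpace X] [BorelSpace X]
    (g : OpenPartialHomeomorph X ℂ → ℂ → ℝ) (φ : OpenPartialHomeomorph X ℂ) :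
    AEMeasurable φ.symm
      ((volume.restrict φ.target).withDensity (fun z => ENNReal.ofReal (g φ z))) :=
  (φ.continuousOn_symm.aemeasurable φ.open_target.measurableSet).mono_ac
    (withDensity_absolutelyContinuous _ _)

theorem chartMeasure_apply [MeasurableSpace X] [BorelSpace X]
    (g : OpenPartialHomeomorph X ℂ → ℂ → ℝ)
    (φ : OpenPartialHomeomorph X ℂ) {A : Set X} (hA : MeasurableSet A) :
    chartMeasure g φ A = ∫⁻ z in φ.target ∩ φ.symm ⁻¹' A, ENNReal.ofReal (g φ z) := by
  rw [chartMeasure, Measure.map_apply_of_aemeasurable (aemeasurable_symm g φ) hA,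
    withDensity_apply', Measure.restrict_restrict' φ.open_target.measurableSet, Set.inter_comm]

theorem chartMeasure_restrict_source [MeasurableSpace X] [BorelSpace X]
    (g : OpenPartialHomeomorph X ℂ → ℂ → ℝ) (φ : OpenPartialHomeomorph X ℂ) :
    (chartMeasure g φ).restrict φ.source = chartMeasure g φ := by
  ext A hA
  rw [Measure.restrict_apply hA, chartMeasure_apply g φ hA,
    chartMeasure_apply g φ (hA.inter φ.open_source.measurableSet)]
  congr 2
  ext z
  simp only [Set.mem_inter_iff, Set.mem_preimage]
  exact ⟨fun h => ⟨h.1, h.2.1⟩, fun h => ⟨h.1, h.2, φ.map_target h.1⟩⟩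

theorem abs_det_mul_real (a : ℂ) :
    |((ContinuousLinearMap.toSpanSingleton ℂ a).restrictScalars ℝ : ℂ →L[ℝ] ℂ).det| =
      ‖a‖ ^ 2 := by
  have : ((ContinuousLinearMap.toSpanSingleton ℂ a).restrictScalars ℝ : ℂ →L[ℝ] ℂ).det =
      ‖a‖ ^ 2 := by
    rw [ContinuousLinearMap.det]
    change LinearMap.det (((ContinuousLinearMap.toSpanSingleton ℂ a) : ℂ →ₗ[ℂ] ℂ).restrictScalars ℝ)
      = _
    rw [LinearMap.det_restrictScalars]
    simp [Algebra.norm_complex_eq, Complex.normSq_eq_norm_sq]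
  rw [this, abs_of_nonneg (by positivity)]

variable [ChartedSpace ℂ X] [IsManifold 𝓘(ℂ) ω X] [MeasurableSpace X] [BorelSpace X]

/-- Change of variables: the real Jacobian of the holomorphic transition is `‖τ'‖²`, exactly the
factor in the transformation law of `g`. -/
theorem chartMeasure_eq_of_subset {g : OpenPartialHomeomorph X ℂ → ℂ → ℝ}
    (hg : IsConformalMetric g) {φ ψ : OpenPartialHomeomorph X ℂ} (hφ : φ ∈ atlas ℂ X)
    (hψ : ψ ∈ atlas ℂ X) {A : Set X} (hA : MeasurableSet A) (hsub : A ⊆ φ.source ∩ ψ.source) :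
    chartMeasure g ψ A = chartMeasure g φ A := by
  rw [chartMeasure_apply g φ hA, chartMeasure_apply g ψ hA]
  have himg : (ψ ∘ φ.symm) '' (φ.target ∩ φ.symm ⁻¹' A) = ψ.target ∩ ψ.symm ⁻¹' A := by
    ext w
    constructor
    · rintro ⟨z, ⟨hz, hzA⟩, rfl⟩
      have := (hsub hzA).2
      refine ⟨ψ.map_source this, ?_⟩
      simpa [ψ.left_inv this] using hzA
    · rintro ⟨hw, hwA⟩
      have := (hsub hwA).1
      refine ⟨φ (ψ.symm w), ⟨φ.map_source this, ?_⟩, ?_⟩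
      · simpa [φ.left_inv this] using hwA
      · simp [φ.left_inv this, ψ.right_inv hw]
  have hin : ∀ z ∈ φ.target ∩ φ.symm ⁻¹' A, φ.symm z ∈ φ.source ∩ ψ.source := fun z hz => hsub hz.2
  have hS := measurableSet_target_inter_preimage φ hA
  rw [← himg, lintegral_image_eq_lintegral_abs_det_fderiv_mul volume hS
    (f' := fun z => (ContinuousLinearMap.toSpanSingleton ℂ
      (deriv (ψ ∘ φ.symm) z)).restrictScalars ℝ)]
  · refine setLIntegral_congr_fun hS (fun z hz => ?_)
    have h1 := hg.transform φ hφ ψ hψ _ (hin z hz)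
    rw [φ.right_inv hz.1] at h1
    simp only [abs_det_mul_real, h1, Function.comp_apply]
    rw [ENNReal.ofReal_mul (by positivity)]
  · intro z hz
    have h1 := hasDerivAt_transition hφ hψ (hin z hz)
    rw [φ.right_inv hz.1] at h1
    exact (h1.hasFDerivAt.restrictScalars ℝ).hasFDerivWithinAt
  · intro z hz w hw h
    have h1 : φ.symm z = φ.symm w := ψ.injOn (hin z hz).2 (hin w hw).2 h
    exact φ.symm.injOn hz.1 hw.1 h1

/-- This makes the supremum defining the area measure computable on one chart at a time. -/
theorem areaMeasure_restrict_source {g : OpenPartialHomeomorph X ℂ → ℂ → ℝ}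
    (hg : IsConformalMetric g) {φ : OpenPartialHomeomorph X ℂ} (hφ : φ ∈ atlas ℂ X) :
    (areaMeasure g).restrict φ.source = chartMeasure g φ := by
  have hle : ∀ ψ ∈ atlas ℂ X, chartMeasure g ψ ≤ areaMeasure g := fun ψ hψ =>
    le_iSup₂ (f := fun ψ (_ : ψ ∈ atlas ℂ X) => chartMeasure g ψ) ψ hψ
  have hm := φ.open_source.measurableSet
  apply le_antisymm
  · have h1 : areaMeasure g ≤ chartMeasure g φ + (areaMeasure g).restrict φ.sourceᶜ := by
      refine iSup₂_le (fun ψ hψ => ?_)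
      change chartMeasure g ψ ≤ _
      rw [← Measure.restrict_add_restrict_compl (μ := chartMeasure g ψ) hm]
      refine add_le_add ?_ (Measure.restrict_mono le_rfl (hle ψ hψ))
      rw [← chartMeasure_restrict_source g ψ]
      refine Measure.le_iff.2 (fun A hA => ?_)
      rw [Measure.restrict_apply hA, Measure.restrict_apply (hA.inter hm),
        chartMeasure_eq_of_subset hg hφ hψ ((hA.inter hm).inter ψ.open_source.measurableSet)
          (fun x hx => ⟨hx.1.2, hx.2⟩)]
      exact measure_mono (fun x hx => hx.1.1)
    refine (Measure.restrict_mono le_rfl h1).trans ?_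
    rw [Measure.restrict_add, chartMeasure_restrict_source, Measure.restrict_restrict hm,
      Set.inter_compl_self, Measure.restrict_empty, add_zero]
  · rw [← chartMeasure_restrict_source]
    exact Measure.restrict_mono le_rfl (hle φ hφ)

/-- A small closed ball in a chart is compact and `g` is continuous on it, so the measure is locally
finite. Compactness of `X` does the rest. -/
theorem isFiniteMeasure_areaMeasure [CompactSpace X] {g : OpenPartialHomeomorph X ℂ → ℂ → ℝ}
    (hg : IsConformalMetric g) : IsFiniteMeasure (areaMeasure g) := by
  have : IsLocallyFiniteMeasure (areaMeasure g) := by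
    constructor
    intro x
    set φ := chartAt ℂ x with hφdef
    have hφ : φ ∈ atlas ℂ X := chart_mem_atlas ℂ x
    have hx : x ∈ φ.source := mem_chart_source ℂ x
    obtain ⟨ε, hε, hsub⟩ := Metric.isOpen_iff.1 φ.open_target _ (φ.map_source hx)
    have hK : Metric.closedBall (φ x) (ε / 2) ⊆ φ.target :=
      (Metric.closedBall_subset_ball (by linarith)).trans hsub
    refine ⟨φ.source ∩ φ ⁻¹' Metric.ball (φ x) (ε / 2), ?_, ?_⟩
    · exact (φ.isOpen_inter_preimage Metric.isOpen_ball).mem_nhds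
        ⟨hx, Metric.mem_ball_self (by linarith)⟩
    · have hA : MeasurableSet (φ.source ∩ φ ⁻¹' Metric.ball (φ x) (ε / 2)) :=
        (φ.isOpen_inter_preimage Metric.isOpen_ball).measurableSet
      have h1 : areaMeasure g (φ.source ∩ φ ⁻¹' Metric.ball (φ x) (ε / 2)) =
          chartMeasure g φ (φ.source ∩ φ ⁻¹' Metric.ball (φ x) (ε / 2)) := by
        rw [← areaMeasure_restrict_source hg hφ, Measure.restrict_apply hA,
          Set.inter_eq_left.2 Set.inter_subset_left]
      rw [h1, chartMeasure_apply g φ hA]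
      refine lt_of_le_of_lt (lintegral_mono_set
        (t := Metric.closedBall (φ x) (ε / 2)) ?_) ?_
      · rintro z ⟨hz, hz1, hz2⟩
        rw [Set.mem_preimage, φ.right_inv hz] at hz2
        exact Metric.ball_subset_closedBall hz2
      · have h2 : IntegrableOn (g φ) (Metric.closedBall (φ x) (ε / 2)) :=
          ((hg.smooth φ hφ).continuousOn.mono hK).integrableOn_compact (isCompact_closedBall _ _)
        refine lt_of_le_of_lt (lintegral_mono fun z => ?_) h2.2
        exact Real.ofReal_le_enorm _
  exact CompactSpace.isFiniteMeasure

theorem integral_areaMeasure_eq {g : OpenPartialHomeomorph X ℂ → ℂ → ℝ}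
    (hg : IsConformalMetric g) {φ : OpenPartialHomeomorph X ℂ} (hφ : φ ∈ atlas ℂ X)
    {s : X → ℝ} (hs : Continuous s) (h0 : ∀ x, x ∉ φ.source → s x = 0) :
    ∫ x, s x ∂(areaMeasure g) = ∫ z in φ.target, g φ z * s (φ.symm z) := by
  have ham : AEMeasurable (fun z => ENNReal.ofReal (g φ z)) (volume.restrict φ.target) :=
    ((hg.smooth φ hφ).continuousOn.aemeasurable φ.open_target.measurableSet).ennreal_ofReal
  rw [← setIntegral_eq_integral_of_forall_compl_eq_zero h0, areaMeasure_restrict_source hg hφ,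
    chartMeasure, integral_map (aemeasurable_symm g φ) hs.aestronglyMeasurable,
    integral_withDensity_eq_integral_toReal_smul₀ ham (by simp)]
  refine setIntegral_congr_fun φ.open_target.measurableSet (fun z hz => ?_)
  simp [ENNReal.toReal_ofReal (hg.pos φ hφ z hz).le]

end

/-! ### Smooth families of planar functions -/

section
variable {E : Type*} [NormedAddCommGroup E] [NormedSpace ℝ E] {Φ : ℝ × ℂ → E} {Ω : Set ℂ}

theorem hasDerivAt_prod_left {t : ℝ} {z : ℂ} (h : DifferentiableAt ℝ Φ (t, z)) :
    HasDerivAt (fun s => Φ (s, z)) (fderiv ℝ Φ (t, z) (1, 0)) t := by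
  have h1 : HasDerivAt (fun s : ℝ => (s, z)) ((1 : ℝ), (0 : ℂ)) t :=
    (hasDerivAt_id t).prodMk (hasDerivAt_const t z)
  exact h.hasFDerivAt.comp_hasDerivAt t h1

theorem fderiv_prod_right {t : ℝ} {z : ℂ} (h : DifferentiableAt ℝ Φ (t, z)) (e : ℂ) :
    fderiv ℝ (fun w => Φ (t, w)) z e = fderiv ℝ Φ (t, z) (0, e) := by
  have h1 : HasFDerivAt (fun w : ℂ => Φ (t, w)) _ z :=
    h.hasFDerivAt.comp z (hasFDerivAt_prodMk_right t z)
  rw [h1.fderiv]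
  simp

theorem contDiffAt_of_family (hΩ : IsOpen Ω) {n : ℕ∞ω} (h : ContDiffOn ℝ n Φ (Set.univ ×ˢ Ω))
    (t : ℝ) {z : ℂ} (hz : z ∈ Ω) : ContDiffAt ℝ n Φ (t, z) :=
  h.contDiffAt ((isOpen_univ.prod hΩ).mem_nhds ⟨Set.mem_univ _, hz⟩)

theorem contDiffOn_fderiv_apply (hΩ : IsOpen Ω) (h : ContDiffOn ℝ ∞ Φ (Set.univ ×ˢ Ω))
    (a : ℝ × ℂ) : ContDiffOn ℝ ∞ (fun p => fderiv ℝ Φ p a) (Set.univ ×ˢ Ω) :=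
  (h.fderiv_of_isOpen (isOpen_univ.prod hΩ) (by simp)).clm_apply contDiffOn_const

theorem contDiffOn_slice {n : ℕ∞ω} (h : ContDiffOn ℝ n Φ (Set.univ ×ˢ Ω)) (t : ℝ) :
    ContDiffOn ℝ n (fun z => Φ (t, z)) Ω :=
  h.comp (contDiff_const.prodMk contDiff_id).contDiffOn (fun _ hz => ⟨Set.mem_univ _, hz⟩)

theorem contDiffOn_deriv_family (hΩ : IsOpen Ω) (h : ContDiffOn ℝ ∞ Φ (Set.univ ×ˢ Ω)) (t : ℝ) :
    ContDiffOn ℝ ∞ (fun z => deriv (fun s => Φ (s, z)) t) Ω :=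
  (contDiffOn_slice (contDiffOn_fderiv_apply hΩ h (1, 0)) t).congr (fun _ hz =>
    (hasDerivAt_prod_left ((contDiffAt_of_family hΩ h t hz).differentiableAt (by simp))).deriv)

/-- Derivatives in the parameter and in the plane commute. -/
theorem hasDerivAt_fderiv_family (hΩ : IsOpen Ω) (h : ContDiffOn ℝ ∞ Φ (Set.univ ×ˢ Ω)) (t : ℝ)
    {z : ℂ} (hz : z ∈ Ω) (e : ℂ) :
    HasDerivAt (fun s => fderiv ℝ (fun w => Φ (s, w)) z e)
      (fderiv ℝ (fun w => deriv (fun s => Φ (s, w)) t) z e) t := by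
  have hd : ∀ s, ∀ w ∈ Ω, DifferentiableAt ℝ Φ (s, w) := fun s w hw =>
    (contDiffAt_of_family hΩ h s hw).differentiableAt (by simp)
  have hD : DifferentiableAt ℝ (fderiv ℝ Φ) (t, z) :=
    ((contDiffAt_of_family hΩ h t hz).fderiv_right (m := 1)
      (WithTop.coe_le_coe.2 le_top)).differentiableAt (by norm_num)
  have hDa : ∀ a : ℝ × ℂ, HasFDerivAt (fun p => fderiv ℝ Φ p a)
      ((fderiv ℝ (fderiv ℝ Φ) (t, z)).flip a) (t, z) := by
    intro a
    have := hD.hasFDerivAt.clm_apply (hasFDerivAt_const a (t, z))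
    simpa using this
  have h1 : (fun s => fderiv ℝ (fun w => Φ (s, w)) z e) = fun s => fderiv ℝ Φ (s, z) (0, e) :=
    funext fun s => fderiv_prod_right (hd s z hz) e
  have h2 : (fun w => deriv (fun s => Φ (s, w)) t) =ᶠ[nhds z] fun w => fderiv ℝ Φ (t, w) (1, 0) := by
    filter_upwards [hΩ.mem_nhds hz] with w hw
    exact (hasDerivAt_prod_left (hd t w hw)).deriv
  rw [h1, h2.fderiv_eq, fderiv_prod_right (hDa (1, 0)).differentiableAt, (hDa (1, 0)).fderiv]
  have h3 := hasDerivAt_prod_left (hDa (0, e)).differentiableAt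
  rw [(hDa (0, e)).fderiv] at h3
  -- Symmetry of the second derivative on `ℝ × ℂ` exchanges the parameter direction `(1, 0)` with
  -- the planar direction `(0, e)`.
  have hsymm : IsSymmSndFDerivAt ℝ Φ (t, z) :=
    (contDiffAt_of_family hΩ h t hz).isSymmSndFDerivAt (by
      simp only [minSmoothness_of_isRCLikeNormedField]
      exact WithTop.coe_le_coe.2 le_top)
  convert h3 using 1
  simpa using hsymm.eq (0, e) (1, 0)

end

section
variable {Φ : ℝ × ℂ → ℂ} {Ω : Set ℂ}

theorem contDiffOn_fderiv_family (hΩ : IsOpen Ω) (h : ContDiffOn ℝ ∞ Φ (Set.univ ×ˢ Ω)) (e : ℂ) :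
    ContDiffOn ℝ ∞ (fun p : ℝ × ℂ => fderiv ℝ (fun w => Φ (p.1, w)) p.2 e) (Set.univ ×ˢ Ω) :=
  (contDiffOn_fderiv_apply hΩ h (0, e)).congr (fun p hp =>
    fderiv_prod_right ((contDiffAt_of_family hΩ h p.1 hp.2).differentiableAt (by simp)) e)

theorem contDiffOn_wirtinger_family (hΩ : IsOpen Ω) (h : ContDiffOn ℝ ∞ Φ (Set.univ ×ˢ Ω)) :
    ContDiffOn ℝ ∞ (fun p : ℝ × ℂ => wirtinger (fun w => Φ (p.1, w)) p.2) (Set.univ ×ˢ Ω) :=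
  contDiffOn_const.mul ((contDiffOn_fderiv_family hΩ h 1).sub
    (contDiffOn_const.mul (contDiffOn_fderiv_family hΩ h Complex.I)))

theorem contDiffOn_wirtingerBar_family (hΩ : IsOpen Ω) (h : ContDiffOn ℝ ∞ Φ (Set.univ ×ˢ Ω)) :
    ContDiffOn ℝ ∞ (fun p : ℝ × ℂ => wirtingerBar (fun w => Φ (p.1, w)) p.2) (Set.univ ×ˢ Ω) :=
  contDiffOn_const.mul ((contDiffOn_fderiv_family hΩ h 1).add
    (contDiffOn_const.mul (contDiffOn_fderiv_family hΩ h Complex.I)))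

theorem hasDerivAt_wirtinger_family (hΩ : IsOpen Ω) (h : ContDiffOn ℝ ∞ Φ (Set.univ ×ˢ Ω)) (t : ℝ)
    {z : ℂ} (hz : z ∈ Ω) :
    HasDerivAt (fun s => wirtinger (fun w => Φ (s, w)) z)
      (wirtinger (fun w => deriv (fun s => Φ (s, w)) t) z) t :=
  ((hasDerivAt_fderiv_family hΩ h t hz 1).sub
    ((hasDerivAt_fderiv_family hΩ h t hz Complex.I).const_mul _)).const_mul _

theorem hasDerivAt_wirtingerBar_family (hΩ : IsOpen Ω) (h : ContDiffOn ℝ ∞ Φ (Set.univ ×ˢ Ω))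
    (t : ℝ) {z : ℂ} (hz : z ∈ Ω) :
    HasDerivAt (fun s => wirtingerBar (fun w => Φ (s, w)) z)
      (wirtingerBar (fun w => deriv (fun s => Φ (s, w)) t) z) t :=
  ((hasDerivAt_fderiv_family hΩ h t hz 1).add
    ((hasDerivAt_fderiv_family hΩ h t hz Complex.I).const_mul _)).const_mul _

theorem contDiffOn_wirtinger {k : ℂ → ℂ} (hΩ : IsOpen Ω) (h : ContDiffOn ℝ ∞ k Ω) :
    ContDiffOn ℝ ∞ (wirtinger k) Ω :=
  contDiffOn_slice (contDiffOn_wirtinger_family (Φ := fun p => k p.2) hΩ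
    (h.comp contDiff_snd.contDiffOn (fun _ hp => hp.2))) 0

theorem contDiffOn_wirtingerBar {k : ℂ → ℂ} (hΩ : IsOpen Ω) (h : ContDiffOn ℝ ∞ k Ω) :
    ContDiffOn ℝ ∞ (wirtingerBar k) Ω :=
  contDiffOn_slice (contDiffOn_wirtingerBar_family (Φ := fun p => k p.2) hΩ
    (h.comp contDiff_snd.contDiffOn (fun _ hp => hp.2))) 0

theorem hasDerivAt_norm_sq {k : ℝ → ℂ} {k' : ℂ} {t : ℝ} (h : HasDerivAt k k' t) :
    HasDerivAt (fun s => ‖k s‖ ^ 2) (2 * ((starRingEnd ℂ) (k t) * k').re) t := by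
  have := h.norm_sq
  convert this using 1
  rw [Complex.inner, mul_comm k']

end

/-! ### Differentiation under the integral on the surface -/

section
variable {X : Type*} [TopologicalSpace X] [ChartedSpace ℂ X]

/-- Differentiation under the integral sign for a smooth family of functions on `X`. -/
theorem hasDerivAt_integral_atPoint [CompactSpace X] [MeasurableSpace X] [BorelSpace X]
    {μ : Measure X} [IsFiniteMeasure μ] {S : ℝ → OpenPartialHomeomorph X ℂ → ℂ → ℝ}
    (hS : ∀ t, IsScalar (S t)) (hd : ∀ φ ∈ atlas ℂ X,
      ContDiffOn ℝ 1 (fun p : ℝ × ℂ => S p.1 φ p.2) (Set.univ ×ˢ φ.target)) :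
    HasDerivAt (fun t => ∫ x, atPoint (S t) x ∂μ)
      (∫ x, atPoint (fun φ z => deriv (fun t => S t φ z) 0) x ∂μ) 0 := by
  have hdiff : ∀ φ ∈ atlas ℂ X, ∀ t, ∀ z ∈ φ.target,
      DifferentiableAt ℝ (fun p : ℝ × ℂ => S p.1 φ p.2) (t, z) := fun φ hφ t z hz =>
    (contDiffAt_of_family φ.open_target (hd φ hφ) t hz).differentiableAt (by norm_num)
  have hscal : ∀ t, IsScalar (fun φ z => deriv (fun t => S t φ z) t) := by
    intro t φ hφ ψ hψ x hx
    have : (fun t => S t φ (φ x)) = fun t => S t ψ (ψ x) := funext fun t => hS t φ hφ ψ hψ x hx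
    simp only [this]
  -- `atPoint` uses a chart that jumps with the point. Chart independence allows one fixed chart
  -- near each point, whence joint continuity of the parameter derivative.
  have hcont : Continuous (fun p : ℝ × X =>
      atPoint (fun φ z => deriv (fun t => S t φ z) p.1) p.2) := by
    rw [continuous_iff_continuousAt]
    rintro ⟨t, x⟩
    set φ := chartAt ℂ x with hφdef
    have hφ : φ ∈ atlas ℂ X := chart_mem_atlas ℂ x
    have hx : x ∈ φ.source := mem_chart_source ℂ x
    have h1 : ContinuousAt (fun p : ℝ × ℂ =>
        fderiv ℝ (fun p : ℝ × ℂ => S p.1 φ p.2) p (1, 0)) (t, φ x) :=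
      (((hd φ hφ).continuousOn_fderiv_of_isOpen (isOpen_univ.prod φ.open_target) le_rfl).clm_apply
        continuousOn_const).continuousAt ((isOpen_univ.prod φ.open_target).mem_nhds
          ⟨Set.mem_univ _, φ.map_source hx⟩)
    have h2 : ContinuousAt (fun p : ℝ × X => (p.1, φ p.2)) (t, x) :=
      continuousAt_fst.prodMk
        (ContinuousAt.comp (f := Prod.snd) (g := φ) (φ.continuousAt hx) continuousAt_snd)
    refine (ContinuousAt.comp (f := fun p : ℝ × X => (p.1, φ p.2)) h1 h2).congr ?_
    filter_upwards [continuousAt_snd.eventually (φ.open_source.mem_nhds hx)] with p hp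
    rw [atPoint_eq (hscal p.1) hφ hp]
    exact (hasDerivAt_prod_left (hdiff φ hφ p.1 _ (φ.map_source hp))).deriv.symm
  -- The dominating constant: the derivative is bounded on the compact set `[-1, 1] × X`, and the
  -- measure is finite.
  obtain ⟨M, hM⟩ := ((isCompact_closedBall (0 : ℝ) 1).prod (isCompact_univ (X := X))).bddAbove_image
    (f := fun p : ℝ × X => ‖atPoint (fun φ z => deriv (fun t => S t φ z) p.1) p.2‖)
    hcont.norm.continuousOn
  have hc0 : ∀ t, Continuous (atPoint (S t)) := fun t => continuous_atPoint (hS t)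
    (fun φ hφ => (contDiffOn_slice (hd φ hφ) t).continuousOn)
  have hcpt : ∀ t, Integrable (atPoint (S t)) μ := fun t =>
    (hc0 t).integrable_of_hasCompactSupport (HasCompactSupport.of_compactSpace _)
  refine (hasDerivAt_integral_of_dominated_loc_of_deriv_le (μ := μ) (bound := fun _ => M)
    (F := fun t x => atPoint (S t) x)
    (F' := fun t x => atPoint (fun φ z => deriv (fun t => S t φ z) t) x)
    (Metric.ball_mem_nhds (0 : ℝ) one_pos)
    (Filter.Eventually.of_forall fun t => (hc0 t).aestronglyMeasurable) (hcpt 0)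
    (hcont.comp (continuous_const.prodMk continuous_id)).aestronglyMeasurable
    (Filter.Eventually.of_forall fun x t ht => ?_) (integrable_const M)
    (Filter.Eventually.of_forall fun x t _ => ?_)).2
  · exact hM ⟨(t, x), ⟨Metric.ball_subset_closedBall ht, Set.mem_univ _⟩, rfl⟩
  · have := hasDerivAt_prod_left (hdiff _ (chart_mem_atlas ℂ x) t _ (mem_chart_target ℂ x))
    exact this.differentiableAt.hasDerivAt

end

/-! ### The first variation of the energy -/

section
variable {X : Type*} [TopologicalSpace X]

/-- The integrand `|∂u|² + K(g) u + e^{2u} (c + |β + ∂̄f|²)`. -/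
noncomputable def energyDensity (κ c : ℝ) (g : OpenPartialHomeomorph X ℂ → ℂ → ℝ)
    (β : LocalCoeffs X) (u : X → ℝ) (f : LocalCoeffs X) :
    OpenPartialHomeomorph X ℂ → ℂ → ℝ :=
  fun φ z => normSqPartial g u φ z + gaussCurvature g φ z * u (φ.symm z) +
    Real.exp (2 * u (φ.symm z)) * (c + normSqBeltrami κ g (β + dbar f) φ z)

/-- The derivative of `energyDensity` at `(u, f)` in the direction `(v, w)`. -/
noncomputable def variationDensity (κ c : ℝ) (g : OpenPartialHomeomorph X ℂ → ℂ → ℝ)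
    (β : LocalCoeffs X) (u : X → ℝ) (f : LocalCoeffs X) (v : X → ℝ) (w : LocalCoeffs X) :
    OpenPartialHomeomorph X ℂ → ℂ → ℝ :=
  fun φ z => crossPartial g u v φ z + gaussCurvature g φ z * v (φ.symm z) +
    2 * Real.exp (2 * u (φ.symm z)) * v (φ.symm z) * (c + normSqBeltrami κ g (β + dbar f) φ z) +
    Real.exp (2 * u (φ.symm z)) * crossBeltrami κ (β + dbar f) (dbar w) φ z

variable [ChartedSpace ℂ X]

theorem isTensor_zero (p q : ℤ) : IsTensor p q (0 : LocalCoeffs X) := by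
  intro φ _ ψ _ x _
  simp

theorem isSmoothTensor_zero (p q : ℤ) : IsSmoothTensor p q (0 : LocalCoeffs X) :=
  ⟨isTensor_zero p q, fun _ _ => contDiffOn_const⟩

/-- The first variation at `(u, f)` in the direction `(v, w)`. -/
noncomputable def firstVariation [MeasurableSpace X] (κ c : ℝ)
    (g : OpenPartialHomeomorph X ℂ → ℂ → ℝ) (β : LocalCoeffs X) (u : X → ℝ) (f : LocalCoeffs X)
    (v : X → ℝ) (w : LocalCoeffs X) : ℝ :=
  ∫ x, atPoint (variationDensity κ c g β u f v w) x ∂(areaMeasure g)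

theorem IsSmoothFamily.contMDiff {U : ℝ → X → ℝ} {F : ℝ → LocalCoeffs X}
    (h : IsSmoothFamily U F) (t : ℝ) : ContMDiff 𝓘(ℝ, ℂ) 𝓘(ℝ, ℝ) ∞ (U t) :=
  h.smooth_fun.comp (contMDiff_const.prodMk contMDiff_id)

theorem IsSmoothFamily.isSmoothTensor {U : ℝ → X → ℝ} {F : ℝ → LocalCoeffs X}
    (h : IsSmoothFamily U F) (t : ℝ) : IsSmoothTensor 1 0 (F t) :=
  ⟨h.transform t, fun φ hφ => contDiffOn_slice (h.smooth_field φ hφ) t⟩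

theorem IsSmoothFamily.isSmoothTensor_deriv {U : ℝ → X → ℝ} {F : ℝ → LocalCoeffs X}
    (h : IsSmoothFamily U F) (t : ℝ) :
    IsSmoothTensor 1 0 (fun φ z => deriv (fun s => F s φ z) t) := by
  refine ⟨fun φ hφ ψ hψ x hx => ?_, fun φ hφ =>
    contDiffOn_deriv_family φ.open_target (h.smooth_field φ hφ) t⟩
  have : (fun s => F s ψ (ψ x)) = fun s => _ := funext fun s => h.transform s φ hφ ψ hψ x hx
  simp only [this]
  exact deriv_const_mul_field _

theorem contDiffOn_gaussCurvature {g : OpenPartialHomeomorph X ℂ → ℂ → ℝ}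
    (hg : IsConformalMetric g) {φ : OpenPartialHomeomorph X ℂ} (hφ : φ ∈ atlas ℂ X) :
    ContDiffOn ℝ ∞ (gaussCurvature g φ) φ.target := by
  have h1 : ContDiffOn ℝ ∞ (fun w => Real.log (g φ w)) φ.target :=
    (hg.smooth φ hφ).log (fun z hz => (hg.pos φ hφ z hz).ne')
  have h2 := (h1.fderiv_of_isOpen φ.open_target (m := ∞) (by simp)).fderiv_of_isOpen
    φ.open_target (m := ∞) (by simp)
  unfold gaussCurvature
  simp_rw [laplacian_eq_fderiv]
  refine ContDiffOn.div (ContDiffOn.neg (ContDiffOn.add ?_ ?_))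
    (contDiffOn_const.mul (hg.smooth φ hφ)) (fun z hz => ?_)
  · exact (h2.clm_apply contDiffOn_const).clm_apply contDiffOn_const
  · exact (h2.clm_apply contDiffOn_const).clm_apply contDiffOn_const
  · exact mul_ne_zero two_ne_zero (hg.pos φ hφ z hz).ne'

variable [IsManifold 𝓘(ℂ) ω X]

theorem IsSmoothFamily.contMDiff_deriv {U : ℝ → X → ℝ} {F : ℝ → LocalCoeffs X}
    (h : IsSmoothFamily U F) (t : ℝ) :
    ContMDiff 𝓘(ℝ, ℂ) 𝓘(ℝ, ℝ) ∞ (fun x => deriv (fun s => U s x) t) :=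
  contMDiff_of_forall_contDiffOn (fun φ hφ =>
    contDiffOn_deriv_family φ.open_target (contDiffOn_family_comp_symm h.smooth_fun hφ) t)

theorem contDiffOn_family_ofReal {U : ℝ → X → ℝ}
    (hU : ContMDiff (𝓘(ℝ, ℝ).prod 𝓘(ℝ, ℂ)) 𝓘(ℝ, ℝ) ∞ (fun p : ℝ × X => U p.1 p.2))
    {φ : OpenPartialHomeomorph X ℂ} (hφ : φ ∈ atlas ℂ X) :
    ContDiffOn ℝ ∞ (fun p : ℝ × ℂ => (U p.1 (φ.symm p.2) : ℂ)) (Set.univ ×ˢ φ.target) :=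
  Complex.ofRealCLM.contDiff.comp_contDiffOn (contDiffOn_family_comp_symm hU hφ)

theorem contDiffOn_ofReal_comp_symm {u : X → ℝ} (hu : ContMDiff 𝓘(ℝ, ℂ) 𝓘(ℝ, ℝ) ∞ u)
    {φ : OpenPartialHomeomorph X ℂ} (hφ : φ ∈ atlas ℂ X) :
    ContDiffOn ℝ ∞ (fun z => (u (φ.symm z) : ℂ)) φ.target :=
  Complex.ofRealCLM.contDiff.comp_contDiffOn (contDiffOn_comp_symm hu hφ)

theorem contDiffOn_energyDensity (κ c : ℝ) {g : OpenPartialHomeomorph X ℂ → ℂ → ℝ}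
    (hg : IsConformalMetric g) {β : LocalCoeffs X} (hβ : IsSmoothTensor 1 (-1) β)
    {U : ℝ → X → ℝ} {F : ℝ → LocalCoeffs X} (h : IsSmoothFamily U F)
    {φ : OpenPartialHomeomorph X ℂ} (hφ : φ ∈ atlas ℂ X) :
    ContDiffOn ℝ ∞ (fun p : ℝ × ℂ => energyDensity κ c g β (U p.1) (F p.1) φ p.2)
      (Set.univ ×ˢ φ.target) := by
  have hsnd : Set.MapsTo (Prod.snd : ℝ × ℂ → ℂ) (Set.univ ×ˢ φ.target) φ.target :=
    fun p hp => hp.2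
  have hg' : ContDiffOn ℝ ∞ (fun p : ℝ × ℂ => g φ p.2) (Set.univ ×ˢ φ.target) :=
    (hg.smooth φ hφ).comp contDiff_snd.contDiffOn hsnd
  have hK : ContDiffOn ℝ ∞ (fun p : ℝ × ℂ => gaussCurvature g φ p.2) (Set.univ ×ˢ φ.target) :=
    (contDiffOn_gaussCurvature hg hφ).comp contDiff_snd.contDiffOn hsnd
  have hβ' : ContDiffOn ℝ ∞ (fun p : ℝ × ℂ => β φ p.2) (Set.univ ×ˢ φ.target) :=
    (hβ.smooth φ hφ).comp contDiff_snd.contDiffOn hsnd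
  have hU := contDiffOn_family_comp_symm h.smooth_fun hφ
  have hW := contDiffOn_wirtinger_family φ.open_target (contDiffOn_family_ofReal h.smooth_fun hφ)
  have hB := hβ'.add (contDiffOn_wirtingerBar_family φ.open_target (h.smooth_field φ hφ))
  have hkey : ContDiffOn ℝ ∞ (fun p : ℝ × ℂ =>
      2 / g φ p.2 * ‖wirtinger (fun w => (U p.1 (φ.symm w) : ℂ)) p.2‖ ^ 2 +
      gaussCurvature g φ p.2 * U p.1 (φ.symm p.2) +
      Real.exp (2 * U p.1 (φ.symm p.2)) *
        (c + κ * ‖β φ p.2 + wirtingerBar (F p.1 φ) p.2‖ ^ 2)) (Set.univ ×ˢ φ.target) := by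
    refine ContDiffOn.add (ContDiffOn.add (ContDiffOn.mul ?_ (hW.norm_sq ℝ)) (hK.mul hU))
      (ContDiffOn.mul (contDiffOn_const.mul hU).exp
        (contDiffOn_const.add (contDiffOn_const.mul (hB.norm_sq ℝ))))
    exact contDiffOn_const.div hg' (fun p hp => (hg.pos φ hφ _ hp.2).ne')
  refine hkey.congr (fun p hp => ?_)
  rw [energyDensity, normSqBeltrami_eq κ hg _ hφ hp.2]
  rfl

theorem isScalar_energyDensity (κ c : ℝ) {g : OpenPartialHomeomorph X ℂ → ℂ → ℝ}
    (hg : IsConformalMetric g) {β : LocalCoeffs X} (hβ : IsSmoothTensor 1 (-1) β)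
    {u : X → ℝ} (hu : ContMDiff 𝓘(ℝ, ℂ) 𝓘(ℝ, ℝ) ∞ u) {f : LocalCoeffs X}
    (hf : IsSmoothTensor 1 0 f) : IsScalar (energyDensity κ c g β u f) := by
  intro φ hφ ψ hψ x hx
  have hB := hβ.transform.add (isTensor_dbar hf)
  unfold energyDensity
  rw [normSqPartial_eq, normSqPartial_eq, normSqBeltrami_eq_cross κ hg _ hφ (φ.map_source hx.1),
    normSqBeltrami_eq_cross κ hg _ hψ (ψ.map_source hx.2),
    isScalar_crossPartial hg hu hu φ hφ ψ hψ x hx, isScalar_gaussCurvature hg φ hφ ψ hψ x hx,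
    isScalar_crossBeltrami κ hB hB φ hφ ψ hψ x hx, φ.left_inv hx.1, ψ.left_inv hx.2]

theorem isScalar_variationDensity (κ c : ℝ) {g : OpenPartialHomeomorph X ℂ → ℂ → ℝ}
    (hg : IsConformalMetric g) {β : LocalCoeffs X} (hβ : IsSmoothTensor 1 (-1) β)
    {u : X → ℝ} (hu : ContMDiff 𝓘(ℝ, ℂ) 𝓘(ℝ, ℝ) ∞ u) {f : LocalCoeffs X}
    (hf : IsSmoothTensor 1 0 f) {v : X → ℝ} (hv : ContMDiff 𝓘(ℝ, ℂ) 𝓘(ℝ, ℝ) ∞ v)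
    {w : LocalCoeffs X} (hw : IsSmoothTensor 1 0 w) :
    IsScalar (variationDensity κ c g β u f v w) := by
  intro φ hφ ψ hψ x hx
  have hB := hβ.transform.add (isTensor_dbar hf)
  unfold variationDensity
  rw [normSqBeltrami_eq_cross κ hg _ hφ (φ.map_source hx.1),
    normSqBeltrami_eq_cross κ hg _ hψ (ψ.map_source hx.2),
    isScalar_crossPartial hg hu hv φ hφ ψ hψ x hx, isScalar_gaussCurvature hg φ hφ ψ hψ x hx,
    isScalar_crossBeltrami κ hB hB φ hφ ψ hψ x hx,
    isScalar_crossBeltrami κ hB (isTensor_dbar hw) φ hφ ψ hψ x hx,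
    φ.left_inv hx.1, ψ.left_inv hx.2]

theorem contDiffOn_variationDensity (κ c : ℝ) {g : OpenPartialHomeomorph X ℂ → ℂ → ℝ}
    (hg : IsConformalMetric g) {β : LocalCoeffs X} (hβ : IsSmoothTensor 1 (-1) β)
    {u : X → ℝ} (hu : ContMDiff 𝓘(ℝ, ℂ) 𝓘(ℝ, ℝ) ∞ u) {f : LocalCoeffs X}
    (hf : IsSmoothTensor 1 0 f) {v : X → ℝ} (hv : ContMDiff 𝓘(ℝ, ℂ) 𝓘(ℝ, ℝ) ∞ v)
    {w : LocalCoeffs X} (hw : IsSmoothTensor 1 0 w) {φ : OpenPartialHomeomorph X ℂ}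
    (hφ : φ ∈ atlas ℂ X) : ContDiffOn ℝ ∞ (variationDensity κ c g β u f v w φ) φ.target := by
  have hB := (hβ.smooth φ hφ).add (contDiffOn_wirtingerBar φ.open_target (hf.smooth φ hφ))
  have hw' := contDiffOn_wirtingerBar φ.open_target (hw.smooth φ hφ)
  have hu1 := contDiffOn_comp_symm hu hφ
  have hv1 := contDiffOn_comp_symm hv hφ
  have hu2 := contDiffOn_wirtinger φ.open_target (contDiffOn_ofReal_comp_symm hu hφ)
  have hv2 := contDiffOn_wirtinger φ.open_target (contDiffOn_ofReal_comp_symm hv hφ)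
  have hre : ∀ {a b : ℂ → ℂ}, ContDiffOn ℝ ∞ a φ.target → ContDiffOn ℝ ∞ b φ.target →
      ContDiffOn ℝ ∞ (fun z => ((starRingEnd ℂ) (a z) * b z).re) φ.target := by
    intro a b ha hb
    exact Complex.reCLM.contDiff.comp_contDiffOn
      ((Complex.conjCLE.contDiff.comp_contDiffOn ha).mul hb)
  have hkey : ContDiffOn ℝ ∞ (fun z =>
      4 / g φ z * ((starRingEnd ℂ) (wirtinger (fun w => (u (φ.symm w) : ℂ)) z) *
        wirtinger (fun w => (v (φ.symm w) : ℂ)) z).re +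
      gaussCurvature g φ z * v (φ.symm z) +
      2 * Real.exp (2 * u (φ.symm z)) * v (φ.symm z) *
        (c + κ * ‖β φ z + wirtingerBar (f φ) z‖ ^ 2) +
      Real.exp (2 * u (φ.symm z)) * (2 * κ * ((starRingEnd ℂ) (β φ z + wirtingerBar (f φ) z) *
        wirtingerBar (w φ) z).re)) φ.target := by
    refine ContDiffOn.add (ContDiffOn.add (ContDiffOn.add (ContDiffOn.mul ?_ (hre hu2 hv2))
      ((contDiffOn_gaussCurvature hg hφ).mul hv1)) (ContDiffOn.mul
        ((contDiffOn_const.mul (contDiffOn_const.mul hu1).exp).mul hv1)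
        (contDiffOn_const.add (contDiffOn_const.mul (hB.norm_sq ℝ)))))
      ((contDiffOn_const.mul hu1).exp.mul (contDiffOn_const.mul (hre hB hw')))
    exact contDiffOn_const.div (hg.smooth φ hφ) (fun z hz => (hg.pos φ hφ _ hz).ne')
  refine hkey.congr (fun z hz => ?_)
  rw [variationDensity, normSqBeltrami_eq κ hg _ hφ hz]
  rfl

theorem continuous_atPoint_variationDensity (κ c : ℝ) {g : OpenPartialHomeomorph X ℂ → ℂ → ℝ}
    (hg : IsConformalMetric g) {β : LocalCoeffs X} (hβ : IsSmoothTensor 1 (-1) β)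
    {u : X → ℝ} (hu : ContMDiff 𝓘(ℝ, ℂ) 𝓘(ℝ, ℝ) ∞ u) {f : LocalCoeffs X}
    (hf : IsSmoothTensor 1 0 f) {v : X → ℝ} (hv : ContMDiff 𝓘(ℝ, ℂ) 𝓘(ℝ, ℝ) ∞ v)
    {w : LocalCoeffs X} (hw : IsSmoothTensor 1 0 w) :
    Continuous (atPoint (variationDensity κ c g β u f v w)) :=
  continuous_atPoint (isScalar_variationDensity κ c hg hβ hu hf hv hw)
    (fun _ hφ => (contDiffOn_variationDensity κ c hg hβ hu hf hv hw hφ).continuousOn)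

theorem hasDerivAt_energyDensity (κ c : ℝ) {g : OpenPartialHomeomorph X ℂ → ℂ → ℝ}
    (hg : IsConformalMetric g) {β : LocalCoeffs X}
    {U : ℝ → X → ℝ} {F : ℝ → LocalCoeffs X} (h : IsSmoothFamily U F)
    {φ : OpenPartialHomeomorph X ℂ} (hφ : φ ∈ atlas ℂ X) {z : ℂ} (hz : z ∈ φ.target) :
    HasDerivAt (fun t => energyDensity κ c g β (U t) (F t) φ z)
      (variationDensity κ c g β (U 0) (F 0) (fun x => deriv (fun s => U s x) 0)
        (fun φ z => deriv (fun s => F s φ z) 0) φ z) 0 := by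
  have hUd : ∀ w ∈ φ.target, DifferentiableAt ℝ (fun s => U s (φ.symm w)) 0 := fun w hw =>
    (hasDerivAt_prod_left ((contDiffAt_of_family φ.open_target
      (contDiffOn_family_comp_symm h.smooth_fun hφ) 0 hw).differentiableAt
        (by simp))).differentiableAt
  have hU := (hUd z hz).hasDerivAt
  have hW := hasDerivAt_wirtinger_family φ.open_target
    (contDiffOn_family_ofReal h.smooth_fun hφ) 0 hz
  have hB := (hasDerivAt_wirtingerBar_family φ.open_target (h.smooth_field φ hφ) 0 hz).const_add
    (β φ z)
  -- The parameter derivative of the complexified family has to be recognised as the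
  -- complexification of the real one, so that it is the Wirtinger derivative of the velocity of
  -- `U`.
  have hcast : wirtinger (fun w => deriv (fun s => (U s (φ.symm w) : ℂ)) 0) z =
      wirtinger (fun w => ((deriv (fun s => U s (φ.symm w)) 0 : ℝ) : ℂ)) z := by
    have : (fun w => deriv (fun s => (U s (φ.symm w) : ℂ)) 0) =ᶠ[nhds z]
        (fun w => ((deriv (fun s => U s (φ.symm w)) 0 : ℝ) : ℂ)) := by
      filter_upwards [φ.open_target.mem_nhds hz] with w hw
      exact (hUd w hw).hasDerivAt.ofReal_comp.deriv
    unfold wirtinger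
    rw [this.fderiv_eq]
  rw [hcast] at hW
  have hmain := (((hasDerivAt_norm_sq hW).const_mul (2 / g φ z)).add
    (hU.const_mul (gaussCurvature g φ z))).add
    (((hU.const_mul 2).exp).mul (((hasDerivAt_norm_sq hB).const_mul κ).const_add c))
  have hfun : (fun t => energyDensity κ c g β (U t) (F t) φ z) = fun t =>
      2 / g φ z * ‖wirtinger (fun w => (U t (φ.symm w) : ℂ)) z‖ ^ 2 +
      gaussCurvature g φ z * U t (φ.symm z) +
      Real.exp (2 * U t (φ.symm z)) * (c + κ * ‖β φ z + wirtingerBar (F t φ) z‖ ^ 2) := by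
    funext t
    rw [energyDensity, normSqBeltrami_eq κ hg _ hφ hz]
    rfl
  rw [hfun]
  refine hmain.congr_deriv ?_
  rw [variationDensity, normSqBeltrami_eq κ hg _ hφ hz]
  simp only [crossPartial, crossBeltrami, dbar, Pi.add_apply]
  ring

variable [CompactSpace X] [MeasurableSpace X] [BorelSpace X]

theorem hasDerivAt_integral_energyDensity (κ c : ℝ) {g : OpenPartialHomeomorph X ℂ → ℂ → ℝ}
    (hg : IsConformalMetric g) {β : LocalCoeffs X} (hβ : IsSmoothTensor 1 (-1) β)
    {U : ℝ → X → ℝ} {F : ℝ → LocalCoeffs X} (h : IsSmoothFamily U F) :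
    HasDerivAt (fun t => ∫ x, atPoint (energyDensity κ c g β (U t) (F t)) x ∂(areaMeasure g))
      (firstVariation κ c g β (U 0) (F 0) (fun x => deriv (fun s => U s x) 0)
        (fun φ z => deriv (fun s => F s φ z) 0)) 0 := by
  have := isFiniteMeasure_areaMeasure hg
  refine (hasDerivAt_integral_atPoint (μ := areaMeasure g)
    (S := fun t => energyDensity κ c g β (U t) (F t))
    (fun t => isScalar_energyDensity κ c hg hβ (h.contMDiff t) (h.isSmoothTensor t))
    (fun φ hφ => (contDiffOn_energyDensity κ c hg hβ h hφ).of_le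
      (WithTop.coe_le_coe.2 le_top))).congr_deriv ?_
  refine integral_congr_ae (Filter.Eventually.of_forall fun x => ?_)
  exact (hasDerivAt_energyDensity κ c hg h (chart_mem_atlas ℂ x) (mem_chart_target ℂ x)).deriv

end

/-! ### The Lagrange multiplier -/

theorem dbar_zero {X : Type*} [TopologicalSpace X] : dbar (0 : LocalCoeffs X) = 0 := by
  funext φ z
  change wirtingerBar (fun _ => 0) z = 0
  simp [wirtingerBar]

theorem wirtinger_const (a : ℂ) (z : ℂ) : wirtinger (fun _ => a) z = 0 := by
  simp [wirtinger]

section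
variable {X : Type*} [TopologicalSpace X]

/-- Separates the three contributions: the function direction, the constraint weighted by `c`, and
the field direction. -/
theorem variationDensity_eq (κ c : ℝ) (g : OpenPartialHomeomorph X ℂ → ℂ → ℝ)
    (β : LocalCoeffs X) (u : X → ℝ) (f : LocalCoeffs X) (v : X → ℝ) (w : LocalCoeffs X)
    (φ : OpenPartialHomeomorph X ℂ) (z : ℂ) :
    variationDensity κ c g β u f v w φ z = variationDensity κ 0 g β u f v 0 φ z +
      2 * c * (Real.exp (2 * u (φ.symm z)) * v (φ.symm z)) +
      variationDensity κ 0 g β u f 0 w φ z := by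
  have h1 : crossPartial g u 0 φ z = 0 := by
    simp [crossPartial, wirtinger_const]
  have h2 : crossBeltrami κ (β + dbar f) (dbar 0) φ z = 0 := by
    simp [crossBeltrami, dbar_zero]
  simp only [variationDensity, h1, h2, Pi.zero_apply]
  ring

theorem variationDensity_sub_const (κ : ℝ) (g : OpenPartialHomeomorph X ℂ → ℂ → ℝ)
    (β : LocalCoeffs X) (u : X → ℝ) (f : LocalCoeffs X) (v : X → ℝ) (m : ℝ)
    (φ : OpenPartialHomeomorph X ℂ) (z : ℂ) :
    variationDensity κ 0 g β u f (fun x => v x - m) 0 φ z = variationDensity κ 0 g β u f v 0 φ z -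
      m * variationDensity κ 0 g β u f (fun _ => 1) 0 φ z := by
  have h1 : crossPartial g u (fun _ => 1) φ z = 0 := by
    simp [crossPartial, wirtinger_const]
  have h2 : crossBeltrami κ (β + dbar f) (dbar 0) φ z = 0 := by
    simp [crossBeltrami, dbar_zero]
  have h3 : crossPartial g u (fun x => v x - m) φ z = crossPartial g u v φ z := by
    have : wirtinger (fun w => ((v (φ.symm w) - m : ℝ) : ℂ)) z =
        wirtinger (fun w => (v (φ.symm w) : ℂ)) z := by
      simp only [Complex.ofReal_sub, wirtinger, fderiv_sub_const]
    rw [crossPartial, this, crossPartial]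
  simp only [variationDensity, h1, h2, h3]
  ring

variable [ChartedSpace ℂ X]

theorem reducedFunctional_eq [MeasurableSpace X] (κ : ℝ) (g : OpenPartialHomeomorph X ℂ → ℂ → ℝ)
    (β : LocalCoeffs X) (C : ℝ) (u : X → ℝ) (f : LocalCoeffs X) :
    reducedFunctional κ g β C u f =
      (∫ x, atPoint (energyDensity κ 0 g β u f) x ∂(areaMeasure g)) + C := by
  simp [reducedFunctional, atPoint, energyDensity]

theorem donaldsonFunctional_eq [MeasurableSpace X] (κ lam : ℝ)
    (g : OpenPartialHomeomorph X ℂ → ℂ → ℝ)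
    (β : LocalCoeffs X) (C : ℝ) (u : X → ℝ) (f : LocalCoeffs X) :
    donaldsonFunctional κ lam g β C u f =
      (∫ x, atPoint (energyDensity κ (-lam / 2) g β u f) x ∂(areaMeasure g)) + C := by
  simp [donaldsonFunctional, atPoint, energyDensity]

/-- Allows any variation of `u` to be brought back to the constraint by an explicit additive
constant. -/
theorem area_add_const [MeasurableSpace X] (g : OpenPartialHomeomorph X ℂ → ℂ → ℝ) (u : X → ℝ) (k : ℝ) :
    area g (fun x => u x + k) = Real.exp (2 * k) * area g u := by
  unfold area
  rw [← integral_const_mul]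
  refine integral_congr_ae (Filter.Eventually.of_forall fun x => ?_)
  simp only [← Real.exp_add]
  ring_nf

variable [IsManifold 𝓘(ℂ) ω X] [CompactSpace X] [MeasurableSpace X] [BorelSpace X]

theorem integrable_of_continuous {g : OpenPartialHomeomorph X ℂ → ℂ → ℝ}
    (hg : IsConformalMetric g) {s : X → ℝ} (hs : Continuous s) : Integrable s (areaMeasure g) := by
  have := isFiniteMeasure_areaMeasure hg
  exact hs.integrable_of_hasCompactSupport (HasCompactSupport.of_compactSpace _)

theorem firstVariation_eq (κ c : ℝ) {g : OpenPartialHomeomorph X ℂ → ℂ → ℝ}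
    (hg : IsConformalMetric g) {β : LocalCoeffs X} (hβ : IsSmoothTensor 1 (-1) β)
    {u : X → ℝ} (hu : ContMDiff 𝓘(ℝ, ℂ) 𝓘(ℝ, ℝ) ∞ u) {f : LocalCoeffs X}
    (hf : IsSmoothTensor 1 0 f) {v : X → ℝ} (hv : ContMDiff 𝓘(ℝ, ℂ) 𝓘(ℝ, ℝ) ∞ v)
    {w : LocalCoeffs X} (hw : IsSmoothTensor 1 0 w) :
    firstVariation κ c g β u f v w = firstVariation κ 0 g β u f v 0 +
      2 * c * ∫ x, Real.exp (2 * u x) * v x ∂(areaMeasure g) + firstVariation κ 0 g β u f 0 w := by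
  have h0 : ContMDiff 𝓘(ℝ, ℂ) 𝓘(ℝ, ℝ) ∞ (0 : X → ℝ) := contMDiff_const
  have i1 := integrable_of_continuous hg (continuous_atPoint_variationDensity κ 0 hg hβ hu hf hv
    (isSmoothTensor_zero 1 0))
  have i2 := integrable_of_continuous hg
    (continuous_atPoint_variationDensity κ 0 hg hβ hu hf h0 hw)
  have hu' := hu.continuous
  have hv' := hv.continuous
  have i3 := (integrable_of_continuous hg (s := fun x => Real.exp (2 * u x) * v x)
    (by fun_prop)).const_mul (2 * c)
  have i13 : Integrable (fun x => atPoint (variationDensity κ 0 g β u f v 0) x +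
      2 * c * (Real.exp (2 * u x) * v x)) (areaMeasure g) := i1.add i3
  unfold firstVariation
  rw [← integral_const_mul, ← integral_add i1 i3, ← integral_add i13 i2]
  refine integral_congr_ae (Filter.Eventually.of_forall fun x => ?_)
  simp only [atPoint]
  rw [variationDensity_eq, (chartAt ℂ x).left_inv (mem_chart_source ℂ x)]

theorem firstVariation_sub_const (κ : ℝ) {g : OpenPartialHomeomorph X ℂ → ℂ → ℝ}
    (hg : IsConformalMetric g) {β : LocalCoeffs X} (hβ : IsSmoothTensor 1 (-1) β)
    {u : X → ℝ} (hu : ContMDiff 𝓘(ℝ, ℂ) 𝓘(ℝ, ℝ) ∞ u) {f : LocalCoeffs X}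
    (hf : IsSmoothTensor 1 0 f) {v : X → ℝ} (hv : ContMDiff 𝓘(ℝ, ℂ) 𝓘(ℝ, ℝ) ∞ v) (m : ℝ) :
    firstVariation κ 0 g β u f (fun x => v x - m) 0 = firstVariation κ 0 g β u f v 0 -
      m * firstVariation κ 0 g β u f (fun _ => 1) 0 := by
  have i1 := integrable_of_continuous hg (continuous_atPoint_variationDensity κ 0 hg hβ hu hf hv
    (isSmoothTensor_zero 1 0))
  have i2 := (integrable_of_continuous hg (continuous_atPoint_variationDensity κ 0 hg hβ hu hf
    (contMDiff_const (c := (1 : ℝ))) (isSmoothTensor_zero 1 0))).const_mul m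
  unfold firstVariation
  rw [← integral_const_mul, ← integral_sub i1 i2]
  refine integral_congr_ae (Filter.Eventually.of_forall fun x => ?_)
  exact variationDensity_sub_const κ g β u f v m _ _

/-- The area along the family `u + t v` depends smoothly on `t`. -/
theorem area_add_smul {g : OpenPartialHomeomorph X ℂ → ℂ → ℝ} (hg : IsConformalMetric g)
    {u v : X → ℝ} (hu : Continuous u) (hv : Continuous v) :
    ContDiff ℝ ∞ (fun t : ℝ => area g (fun x => u x + t * v x)) ∧
      HasDerivAt (fun t : ℝ => area g (fun x => u x + t * v x))
        (2 * ∫ x, Real.exp (2 * u x) * v x ∂(areaMeasure g)) 0 := by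
  have := isFiniteMeasure_areaMeasure hg
  have hcu : Continuous (fun x => Real.exp (2 * u x)) := by fun_prop
  set ν := (areaMeasure g).withDensity (fun x => ENNReal.ofReal (Real.exp (2 * u x))) with hν
  have hint : ∀ s : X → ℝ, ∫ x, s x ∂ν = ∫ x, Real.exp (2 * u x) * s x ∂(areaMeasure g) := by
    intro s
    rw [hν, integral_withDensity_eq_integral_toReal_smul₀
      hcu.measurable.ennreal_ofReal.aemeasurable (by simp)]
    simp [ENNReal.toReal_ofReal (Real.exp_pos _).le]
  have hfin : IsFiniteMeasure ν :=
    isFiniteMeasure_withDensity_ofReal (integrable_of_continuous hg hcu).2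
  -- Along `u + tv` the area is the moment generating function of `2v` for the finite measure
  -- `e^{2u} dμ`. As `v` is bounded it is finite for all `t`, hence analytic, and its derivative at
  -- `0` is the mean of `2v`.
  have hmgf : (fun t : ℝ => area g (fun x => u x + t * v x)) =
      ProbabilityTheory.mgf (fun x => 2 * v x) ν := by
    funext t
    rw [ProbabilityTheory.mgf, hint, area]
    refine integral_congr_ae (Filter.Eventually.of_forall fun x => ?_)
    simp only [← Real.exp_add]
    ring_nf
  have huniv : ProbabilityTheory.integrableExpSet (fun x => 2 * v x) ν = Set.univ := by
    refine Set.eq_univ_of_forall fun t => ?_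
    have hc : Continuous (fun x => Real.exp (t * (2 * v x))) := by fun_prop
    exact hc.integrable_of_hasCompactSupport (HasCompactSupport.of_compactSpace _)
  have hmem : ∀ t, t ∈ interior (ProbabilityTheory.integrableExpSet (fun x => 2 * v x) ν) := by
    simp [huniv]
  rw [hmgf]
  refine ⟨contDiff_iff_contDiffAt.2 fun t =>
    (ProbabilityTheory.analyticAt_mgf (hmem t)).contDiffAt, ?_⟩
  refine (ProbabilityTheory.hasDerivAt_mgf (hmem 0)).congr_deriv ?_
  rw [hint, ← integral_const_mul]
  refine integral_congr_ae (Filter.Eventually.of_forall fun x => ?_)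
  simp
  ring

theorem area_pos {g : OpenPartialHomeomorph X ℂ → ℂ → ℝ} (hg : IsConformalMetric g)
    (h0 : areaMeasure g ≠ 0) {u : X → ℝ} (hu : Continuous u) : 0 < area g u := by
  have : NeZero (areaMeasure g) := ⟨h0⟩
  exact integral_exp_pos (integrable_of_continuous hg
    (Real.continuous_exp.comp (continuous_const.mul hu)))

/-- **Lagrange multiplier rule**. -/
theorem exists_forall_firstVariation_eq_zero {κ : ℝ} {g : OpenPartialHomeomorph X ℂ → ℂ → ℝ}
    (hg : IsConformalMetric g) {β : LocalCoeffs X} (hβ : IsSmoothTensor 1 (-1) β) {C T : ℝ}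
    {u : X → ℝ} {f : LocalCoeffs X}
    (hcrit : IsCriticalPointOn (reducedFunctional κ g β C) (fun v _ => area g v = T) u f) :
    ∃ lam : ℝ, ∀ (v : X → ℝ) (w : LocalCoeffs X), ContMDiff 𝓘(ℝ, ℂ) 𝓘(ℝ, ℝ) ∞ v →
      IsSmoothTensor 1 0 w → firstVariation κ (-lam / 2) g β u f v w = 0 := by
  -- For zero area measure (for instance empty `X`) division by `T` is unavailable, but every first
  -- variation is zero and any multiplier serves.
  by_cases h0 : areaMeasure g = 0
  · exact ⟨0, fun v w _ _ => by simp [firstVariation, h0]⟩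
  have hu := hcrit.smooth_fun
  have hf := hcrit.smooth_field
  have hT : area g u = T := hcrit.constraint
  have hTpos : 0 < T := hT ▸ area_pos hg h0 hu.continuous
  have hfirst : ∀ (U : ℝ → X → ℝ) (F : ℝ → LocalCoeffs X), IsSmoothFamily U F →
      U 0 = u → F 0 = f → (∀ t, area g (U t) = T) →
      firstVariation κ 0 g β u f (fun x => deriv (fun s => U s x) 0)
        (fun φ z => deriv (fun s => F s φ z) 0) = 0 := by
    intro U F h hU hF hA
    have h1 := hcrit.critical U F h hU hF hA
    have h2 := (hasDerivAt_integral_energyDensity κ 0 hg hβ h).add_const C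
    simp only [reducedFunctional_eq] at h1
    rw [hU, hF] at h2
    exact h2.unique h1
  -- The constraint ignores the field, so the straight line `f + tw` is admissible.
  have hfield : ∀ w : LocalCoeffs X, IsSmoothTensor 1 0 w → firstVariation κ 0 g β u f 0 w = 0 := by
    intro w hw
    have hfam : IsSmoothFamily (fun (_ : ℝ) x => u x) (fun t φ z => f φ z + t * w φ z) := by
      refine ⟨hu.comp contMDiff_snd, fun t φ hφ ψ hψ x hx => ?_, fun φ hφ => ?_⟩
      · rw [hf.transform φ hφ ψ hψ x hx, hw.transform φ hφ ψ hψ x hx]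
        ring
      · exact ((hf.smooth φ hφ).comp contDiff_snd.contDiffOn (fun p hp => hp.2)).add
          ((Complex.ofRealCLM.contDiff.comp contDiff_fst).contDiffOn.mul
            ((hw.smooth φ hφ).comp contDiff_snd.contDiffOn (fun p hp => hp.2)))
    have h1 := hfirst _ _ hfam rfl (by funext φ z; simp) (fun _ => hT)
    convert h1 using 2
    · funext x
      simp
    · funext φ z
      have : HasDerivAt (fun s : ℝ => f φ z + (s : ℂ) * w φ z) (((1 : ℝ) : ℂ) * w φ z) 0 :=
        ((hasDerivAt_id (0 : ℝ)).ofReal_comp.mul_const (w φ z)).const_add (f φ z)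
      rw [this.deriv]
      simp
  have hfun : ∀ v : X → ℝ, ContMDiff 𝓘(ℝ, ℂ) 𝓘(ℝ, ℝ) ∞ v → firstVariation κ 0 g β u f v 0 =
      (∫ x, Real.exp (2 * u x) * v x ∂(areaMeasure g)) / T *
        firstVariation κ 0 g β u f (fun _ => 1) 0 := by
    intro v hv
    set m := (∫ x, Real.exp (2 * u x) * v x ∂(areaMeasure g)) / T with hm
    obtain ⟨hA, hA'⟩ := area_add_smul hg hu.continuous hv.continuous
    set A : ℝ → ℝ := fun t => area g (fun x => u x + t * v x) with hAdef
    have hApos : ∀ t, 0 < A t := fun t =>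
      area_pos hg h0 (hu.continuous.add (continuous_const.mul hv.continuous))
    have hA0 : A 0 = T := by simp [hAdef, hT]
    -- The additive correction solves `e^{2k(t)} A(t) = T`. Its derivative at `0` is `-A'(0)/(2T) =
    -- -m`.
    have hk : ContDiff ℝ ∞ (fun t => -(1 / 2) * Real.log (A t / T)) :=
      contDiff_const.mul ((hA.div_const T).log (fun t => (div_pos (hApos t) hTpos).ne'))
    have hk' : HasDerivAt (fun t => -(1 / 2) * Real.log (A t / T)) (-m) 0 := by
      refine (((hA'.div_const T).log (div_pos (hApos 0) hTpos).ne').const_mul _).congr_deriv ?_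
      rw [hA0, hm]
      field_simp
    have hfam : IsSmoothFamily (fun t x => u x + t * v x + -(1 / 2) * Real.log (A t / T))
        (fun _ => f) := by
      refine ⟨?_, fun _ => hf.transform, fun φ hφ =>
        (hf.smooth φ hφ).comp contDiff_snd.contDiffOn (fun p hp => hp.2)⟩
      exact ((hu.comp contMDiff_snd).add (contMDiff_fst.mul (hv.comp contMDiff_snd))).add
        (hk.contMDiff.comp contMDiff_fst)
    have h1 := hfirst _ _ hfam (by funext x; simp [hA0, hTpos.ne']) rfl (fun t => by
      rw [area_add_const]
      change Real.exp (2 * (-(1 / 2) * Real.log (A t / T))) * A t = T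
      have : 2 * (-(1 / 2) * Real.log (A t / T)) = -Real.log (A t / T) := by ring
      rw [this, Real.exp_neg, Real.exp_log (div_pos (hApos t) hTpos)]
      have := (hApos t).ne'
      field_simp)
    have hv' : (fun x => deriv (fun s => u x + s * v x + -(1 / 2) * Real.log (A s / T)) 0) =
        fun x => v x - m := by
      funext x
      have : HasDerivAt (fun s : ℝ => u x + s * v x + -(1 / 2) * Real.log (A s / T))
          (1 * v x + -m) 0 := (((hasDerivAt_id (0 : ℝ)).mul_const (v x)).const_add (u x)).add hk'
      rw [this.deriv]
      ring
    have hw' : (fun φ z => deriv (fun _ : ℝ => f φ z) 0) = (0 : LocalCoeffs X) := by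
      funext φ z
      simp
    rw [hv', hw', firstVariation_sub_const κ hg hβ hu hf hv] at h1
    linarith
  -- With `c = -λ/2` the constraint term is `-λ ∫ e^{2u} v dμ`, and this `λ` cancels it against the
  -- value found in `hfun`.
  refine ⟨firstVariation κ 0 g β u f (fun _ => 1) 0 / T, fun v w hv hw => ?_⟩
  rw [firstVariation_eq κ _ hg hβ hu hf hv hw, hfield w hw, hfun v hv]
  ring

theorem isCriticalPointOn_donaldsonFunctional {κ lam : ℝ}
    {g : OpenPartialHomeomorph X ℂ → ℂ → ℝ}
    (hg : IsConformalMetric g) {β : LocalCoeffs X} (hβ : IsSmoothTensor 1 (-1) β) (C : ℝ)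
    {u : X → ℝ} (hu : ContMDiff 𝓘(ℝ, ℂ) 𝓘(ℝ, ℝ) ∞ u) {f : LocalCoeffs X}
    (hf : IsSmoothTensor 1 0 f)
    (h : ∀ (v : X → ℝ) (w : LocalCoeffs X), ContMDiff 𝓘(ℝ, ℂ) 𝓘(ℝ, ℝ) ∞ v →
      IsSmoothTensor 1 0 w → firstVariation κ (-lam / 2) g β u f v w = 0) :
    IsCriticalPointOn (donaldsonFunctional κ lam g β C) (fun _ _ => True) u f := by
  refine ⟨hu, hf, trivial, fun U F hfam hU hF _ => ?_⟩
  have h2 := (hasDerivAt_integral_energyDensity κ (-lam / 2) hg hβ hfam).add_const C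
  rw [hU, hF, h _ _ (hfam.contMDiff_deriv 0) (hfam.isSmoothTensor_deriv 0)] at h2
  simpa only [donaldsonFunctional_eq] using h2

end

/-! ### Green-type identities for the Laplacian and for `∂̄` -/

/-- Identifies `g` times `crossPartial` with the Euclidean product of gradients: the Dirichlet term
is conformally invariant. -/
theorem four_mul_re_wirtinger {h k : ℂ → ℝ} {z : ℂ} (hh : DifferentiableAt ℝ h z)
    (hk : DifferentiableAt ℝ k z) :
    4 * ((starRingEnd ℂ) (wirtinger (fun w => (h w : ℂ)) z) * wirtinger (fun w => (k w : ℂ)) z).re =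
      fderiv ℝ h z 1 * fderiv ℝ k z 1 + fderiv ℝ h z Complex.I * fderiv ℝ k z Complex.I := by
  have hw : ∀ {h : ℂ → ℝ}, DifferentiableAt ℝ h z → wirtinger (fun w => (h w : ℂ)) z =
      (1 / 2 : ℂ) * ((fderiv ℝ h z 1 : ℝ) - Complex.I * (fderiv ℝ h z Complex.I : ℝ)) := by
    intro h hh
    have h1 : HasFDerivAt (fun w => (h w : ℂ)) (Complex.ofRealCLM.comp (fderiv ℝ h z)) z :=
      Complex.ofRealCLM.hasFDerivAt.comp z hh.hasFDerivAt
    rw [wirtinger, h1.fderiv]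
    simp
  rw [hw hh, hw hk]
  simp
  ring

section
variable {Ω : Set ℂ}

/-- Integration by parts of `h_x` along `1` and of `h_y` along `I`. The integrability statements are
kept so that the integral can later be split and recombined with other terms. -/
theorem integral_fderiv_add_laplacian_eq_zero (hΩ : IsOpen Ω) {h ρ : ℂ → ℝ}
    (hh : ContDiffOn ℝ ∞ h Ω) (hρ : ContDiff ℝ ∞ ρ) (hc : HasCompactSupport ρ)
    (hs : tsupport ρ ⊆ Ω) :
    ∫ z in Ω, (fderiv ℝ h z 1 * fderiv ℝ ρ z 1 + fderiv ℝ h z Complex.I * fderiv ℝ ρ z Complex.I +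
      Laplacian.laplacian h z * ρ z) = 0 ∧
    IntegrableOn (fun z => fderiv ℝ h z 1 * fderiv ℝ ρ z 1 +
      fderiv ℝ h z Complex.I * fderiv ℝ ρ z Complex.I) Ω ∧
    IntegrableOn (fun z => Laplacian.laplacian h z * ρ z) Ω := by
  have hd : ContDiffOn ℝ ∞ (fderiv ℝ h) Ω := hh.fderiv_of_isOpen hΩ (by simp)
  have key : ∀ e : ℂ, ∫ z in Ω, (fderiv ℝ (fderiv ℝ h) z e e * ρ z +
      fderiv ℝ h z e * fderiv ℝ ρ z e) = 0 ∧
      IntegrableOn (fun z => fderiv ℝ (fderiv ℝ h) z e e * ρ z) Ω ∧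
      IntegrableOn (fun z => fderiv ℝ h z e * fderiv ℝ ρ z e) Ω := by
    intro e
    have h1 := integral_fderiv_mul_add_eq_zero hΩ (h := fun z => fderiv ℝ h z e)
      ((hd.clm_apply contDiffOn_const).of_le (by simp)) (hρ.of_le (by simp)) hc hs e
    have h2 : ∀ z ∈ Ω, fderiv ℝ (fun z => fderiv ℝ h z e) z e = fderiv ℝ (fderiv ℝ h) z e e := by
      intro z hz
      have := ((hd.contDiffAt (hΩ.mem_nhds hz)).differentiableAt (by simp)).hasFDerivAt.clm_apply
        (hasFDerivAt_const e z)
      rw [this.fderiv]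
      simp
    refine ⟨?_, h1.2.1.congr_fun (fun z hz => by simp only [h2 z hz]) hΩ.measurableSet, h1.2.2⟩
    rw [← h1.1]
    exact setIntegral_congr_fun hΩ.measurableSet (fun z hz => by simp only [h2 z hz])
  obtain ⟨a1, b1, c1⟩ := key 1
  obtain ⟨a2, b2, c2⟩ := key Complex.I
  refine ⟨?_, c1.add c2, ?_⟩
  · have h3 := integral_add (b1.add c1) (b2.add c2)
    simp only [Pi.add_apply] at h3
    rw [a1, a2, add_zero] at h3
    rw [← h3]
    refine setIntegral_congr_fun hΩ.measurableSet (fun z _ => ?_)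
    simp only [laplacian_eq_fderiv]
    ring
  · refine (b1.add b2).congr_fun (fun z _ => ?_) hΩ.measurableSet
    simp only [laplacian_eq_fderiv, Pi.add_apply]
    ring

theorem integral_wirtingerBar_mul_add_eq_zero (hΩ : IsOpen Ω) {h ρ : ℂ → ℂ}
    (hh : ContDiffOn ℝ ∞ h Ω) (hρ : ContDiff ℝ ∞ ρ) (hc : HasCompactSupport ρ)
    (hs : tsupport ρ ⊆ Ω) :
    ∫ z in Ω, wirtingerBar h z * ρ z = -∫ z in Ω, h z * wirtingerBar ρ z ∧
    IntegrableOn (fun z => wirtingerBar h z * ρ z) Ω ∧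
    IntegrableOn (fun z => h z * wirtingerBar ρ z) Ω := by
  obtain ⟨a1, b1, c1⟩ := integral_fderiv_mul_add_eq_zero hΩ (hh.of_le (by simp))
    (hρ.of_le (by simp)) hc hs 1
  obtain ⟨a2, b2, c2⟩ := integral_fderiv_mul_add_eq_zero hΩ (hh.of_le (by simp))
    (hρ.of_le (by simp)) hc hs Complex.I
  rw [integral_add b1 c1] at a1
  rw [integral_add b2 c2] at a2
  have e1 : (fun z => wirtingerBar h z * ρ z) = fun z =>
      (1 / 2 : ℂ) * (fderiv ℝ h z 1 * ρ z + Complex.I * (fderiv ℝ h z Complex.I * ρ z)) := by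
    funext z
    rw [wirtingerBar]
    ring
  have e2 : (fun z => h z * wirtingerBar ρ z) = fun z =>
      (1 / 2 : ℂ) * (h z * fderiv ℝ ρ z 1 + Complex.I * (h z * fderiv ℝ ρ z Complex.I)) := by
    funext z
    rw [wirtingerBar]
    ring
  refine ⟨?_, ?_, ?_⟩
  · rw [e1, e2, integral_const_mul, integral_const_mul, integral_add b1 (b2.const_mul _),
      integral_add c1 (c2.const_mul _), integral_const_mul, integral_const_mul]
    linear_combination (1 / 2 : ℂ) * a1 + (1 / 2 : ℂ) * Complex.I * a2
  · rw [e1]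
    exact (b1.add (b2.const_mul _)).const_mul _
  · rw [e2]
    exact (c1.add (c2.const_mul _)).const_mul _

end

/-! ### Test functions and test fields supported in a chart -/

section
variable {X : Type*} [TopologicalSpace X]

open scoped Classical in
/-- The function on `X` that is `ρ` in the coordinate `φ`, extended by zero. -/
noncomputable def bumpFun (φ : OpenPartialHomeomorph X ℂ) (ρ : ℂ → ℝ) (x : X) : ℝ :=
  if x ∈ φ.source then ρ (φ x) else 0

open scoped Classical in
/-- The vector field on `X` that is `ρ ∂_z` in the coordinate `z = φ`, extended by zero. -/
noncomputable def bumpField (φ : OpenPartialHomeomorph X ℂ) (ρ : ℂ → ℂ) : LocalCoeffs X :=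
  fun ψ z => if ψ.symm z ∈ φ.source then
    deriv (ψ ∘ φ.symm) (φ (ψ.symm z)) * ρ (φ (ψ.symm z)) else 0

theorem bumpFun_symm (φ : OpenPartialHomeomorph X ℂ) (ρ : ℂ → ℝ) {z : ℂ} (hz : z ∈ φ.target) :
    bumpFun φ ρ (φ.symm z) = ρ z := by
  rw [bumpFun, if_pos (φ.map_target hz), φ.right_inv hz]

theorem bumpField_self (φ : OpenPartialHomeomorph X ℂ) (ρ : ℂ → ℂ) {z : ℂ} (hz : z ∈ φ.target) :
    bumpField φ ρ φ z = ρ z := by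
  have : (φ ∘ φ.symm) =ᶠ[nhds z] id := by
    filter_upwards [φ.open_target.mem_nhds hz] with w hw
    simp [φ.right_inv hw]
  rw [bumpField, if_pos (φ.map_target hz), φ.right_inv hz, this.deriv_eq]
  simp

/-- The support, carried to `X`, is compact and hence closed because `X` is Hausdorff. A point
outside the chart therefore has a neighbourhood missing it, so extension by zero is smooth. -/
theorem eventually_eq_zero_of_notMem_source [T2Space X] {B : Type*} [Zero B] [TopologicalSpace B]
    {φ ψ : OpenPartialHomeomorph X ℂ}
    {ρ : ℂ → B} (hc : HasCompactSupport ρ) (hs : tsupport ρ ⊆ φ.target) {z : ℂ}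
    (hz : z ∈ ψ.target) (hz' : ψ.symm z ∉ φ.source) :
    ∀ᶠ w in nhds z, ψ.symm w ∈ φ.source → ρ (φ (ψ.symm w)) = 0 := by
  have hK : IsClosed (φ.symm '' tsupport ρ) :=
    (IsCompact.image_of_continuousOn hc (φ.continuousOn_symm.mono hs)).isClosed
  have hzK : ψ.symm z ∈ (φ.symm '' tsupport ρ)ᶜ := by
    rintro ⟨w, hw, hwz⟩
    exact hz' (hwz ▸ φ.map_target (hs hw))
  filter_upwards [(ψ.symm.continuousAt hz).eventually (hK.isOpen_compl.mem_nhds hzK)] with w hw hwφ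
  by_contra hne
  exact hw ⟨φ (ψ.symm w), subset_tsupport ρ hne, φ.left_inv hwφ⟩

theorem bumpFun_eventuallyEq_zero [T2Space X] {φ ψ : OpenPartialHomeomorph X ℂ}
    {ρ : ℂ → ℝ} (hc : HasCompactSupport ρ) (hs : tsupport ρ ⊆ φ.target) {z : ℂ}
    (hz : z ∈ ψ.target) (hz' : ψ.symm z ∉ φ.source) :
    (fun w => bumpFun φ ρ (ψ.symm w)) =ᶠ[nhds z] fun _ => 0 := by
  filter_upwards [eventually_eq_zero_of_notMem_source hc hs hz hz'] with w hw
  rw [bumpFun]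
  split_ifs with h
  · exact hw h
  · rfl

theorem bumpField_eventuallyEq_zero [T2Space X] {φ ψ : OpenPartialHomeomorph X ℂ}
    {ρ : ℂ → ℂ} (hc : HasCompactSupport ρ) (hs : tsupport ρ ⊆ φ.target) {z : ℂ}
    (hz : z ∈ ψ.target) (hz' : ψ.symm z ∉ φ.source) :
    bumpField φ ρ ψ =ᶠ[nhds z] fun _ => 0 := by
  filter_upwards [eventually_eq_zero_of_notMem_source hc hs hz hz'] with w hw
  rw [bumpField]
  split_ifs with h
  · rw [hw h, mul_zero]
  · rfl

variable [ChartedSpace ℂ X] [IsManifold 𝓘(ℂ) ω X] [T2Space X]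

theorem contMDiff_bumpFun {φ : OpenPartialHomeomorph X ℂ} (hφ : φ ∈ atlas ℂ X) {ρ : ℂ → ℝ}
    (hρ : ContDiff ℝ ∞ ρ) (hc : HasCompactSupport ρ) (hs : tsupport ρ ⊆ φ.target) :
    ContMDiff 𝓘(ℝ, ℂ) 𝓘(ℝ, ℝ) ∞ (bumpFun φ ρ) := by
  refine contMDiff_of_forall_contDiffOn (fun ψ hψ z hz => ContDiffAt.contDiffWithinAt ?_)
  by_cases hzφ : ψ.symm z ∈ φ.source
  · have ha := analyticAt_transition hψ hφ ⟨ψ.map_target hz, hzφ⟩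
    rw [ψ.right_inv hz] at ha
    refine (hρ.contDiffAt.comp z (ha.contDiffAt.restrict_scalars ℝ)).congr_of_eventuallyEq ?_
    filter_upwards [(ψ.symm.continuousAt hz).eventually (φ.open_source.mem_nhds hzφ)] with w (hw : ψ.symm w ∈ φ.source)
    rw [bumpFun, if_pos hw]
    rfl
  · exact contDiffAt_const.congr_of_eventuallyEq (bumpFun_eventuallyEq_zero hc hs hz hzφ)

theorem isSmoothTensor_bumpField {φ : OpenPartialHomeomorph X ℂ} (hφ : φ ∈ atlas ℂ X) {ρ : ℂ → ℂ}
    (hρ : ContDiff ℝ ∞ ρ) (hc : HasCompactSupport ρ) (hs : tsupport ρ ⊆ φ.target) :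
    IsSmoothTensor 1 0 (bumpField φ ρ) := by
  refine ⟨fun ψ hψ χ hχ x hx => ?_, fun ψ hψ z hz => ContDiffAt.contDiffWithinAt ?_⟩
  · have hψx : ψ.symm (ψ x) = x := ψ.left_inv hx.1
    have hχx : χ.symm (χ x) = x := χ.left_inv hx.2
    by_cases h : x ∈ φ.source
    · rw [bumpField, bumpField, if_pos (by rwa [hχx]), if_pos (by rwa [hψx]), hψx, hχx,
        deriv_transition_comp hφ hψ hχ h hx.1 hx.2]
      simp [mul_assoc]
    · rw [bumpField, bumpField, if_neg (by rwa [hχx]), if_neg (by rwa [hψx]), mul_zero]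
  · by_cases hzφ : ψ.symm z ∈ φ.source
    · have ha := analyticAt_transition hψ hφ ⟨ψ.map_target hz, hzφ⟩
      have hd := (analyticAt_transition hφ hψ ⟨hzφ, ψ.map_target hz⟩).deriv
      rw [ψ.right_inv hz] at ha
      have hd' := AnalyticAt.comp (f := φ ∘ ψ.symm) hd ha
      refine ((hd'.contDiffAt.restrict_scalars ℝ).mul (hρ.contDiffAt.comp z
        (ha.contDiffAt.restrict_scalars ℝ))).congr_of_eventuallyEq ?_
      filter_upwards [(ψ.symm.continuousAt hz).eventually (φ.open_source.mem_nhds hzφ)] with w (hw : ψ.symm w ∈ φ.source)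
      rw [bumpField, if_pos hw]
      rfl
    · exact contDiffAt_const.congr_of_eventuallyEq (bumpField_eventuallyEq_zero hc hs hz hzφ)

end

/-! ### Euler–Lagrange equations and the Gauss–Codazzi system -/

section
variable {X : Type*} [TopologicalSpace X] [ChartedSpace ℂ X]

theorem isConformalMetric_conformalChange [IsManifold 𝓘(ℂ) ω X]
    {g : OpenPartialHomeomorph X ℂ → ℂ → ℝ} (hg : IsConformalMetric g) {u : X → ℝ}
    (hu : ContMDiff 𝓘(ℝ, ℂ) 𝓘(ℝ, ℝ) ∞ u) : IsConformalMetric (conformalChange u g) where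
  pos φ hφ z hz := mul_pos (Real.exp_pos _) (hg.pos φ hφ z hz)
  smooth φ hφ := (contDiffOn_const.mul (contDiffOn_comp_symm hu hφ)).exp.mul (hg.smooth φ hφ)
  transform φ hφ ψ hψ x hx := by
    simp only [conformalChange, φ.left_inv hx.1, ψ.left_inv hx.2, hg.transform φ hφ ψ hψ x hx]
    ring

/-- `conj b` gains `conj τ / τ` and `g` gains `1 / (τ conj τ)`, together `τ⁻²`. -/
theorem isTensor_exp_mul_conjDual [IsManifold 𝓘(ℂ) ω X]
    {g : OpenPartialHomeomorph X ℂ → ℂ → ℝ} (hg : IsConformalMetric g) (u : X → ℝ)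
    {b : LocalCoeffs X} (hb : IsTensor 1 (-1) b) :
    IsTensor (-2) 0 (fun φ z => (Real.exp (2 * u (φ.symm z)) : ℂ) * conjDual g b φ z) := by
  intro φ hφ ψ hψ x hx
  simp only [conjDual, φ.left_inv hx.1, ψ.left_inv hx.2, hg.transform φ hφ ψ hψ x hx,
    hb φ hφ ψ hψ x hx]
  have hn := deriv_transition_ne_zero hφ hψ hx
  generalize deriv (ψ ∘ φ.symm) (φ x) = τ at *
  have hn' : (starRingEnd ℂ) τ ≠ 0 := by simpa using hn
  have h1 : ((‖τ‖ ^ 2 * g ψ (ψ x) : ℝ) : ℂ) = τ * (starRingEnd ℂ) τ * (g ψ (ψ x) : ℂ) := by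
    rw [Complex.mul_conj, Complex.normSq_eq_norm_sq]
    push_cast
    ring
  rw [h1]
  have h2 : τ ^ (-2 : ℤ) = (τ ^ 2)⁻¹ := by rw [zpow_neg]; rfl
  simp only [h2, zpow_neg_one, zpow_one, zpow_zero, map_mul, map_inv₀, Complex.conj_conj]
  field_simp

/-- From `log (e^{2u} g) = 2u + log g`. The identity is cleared of denominators to match the
Euler–Lagrange equation. -/
theorem gaussCurvature_conformalChange [IsManifold 𝓘(ℂ) ω X]
    {g : OpenPartialHomeomorph X ℂ → ℂ → ℝ} (hg : IsConformalMetric g) {u : X → ℝ}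
    (hu : ContMDiff 𝓘(ℝ, ℂ) 𝓘(ℝ, ℝ) ∞ u) {φ : OpenPartialHomeomorph X ℂ} (hφ : φ ∈ atlas ℂ X)
    {z : ℂ} (hz : z ∈ φ.target) :
    Real.exp (2 * u (φ.symm z)) * g φ z * gaussCurvature (conformalChange u g) φ z =
      g φ z * gaussCurvature g φ z - Laplacian.laplacian (fun w => u (φ.symm w)) z := by
  have hlog : ContDiffAt ℝ 2 (fun w => Real.log (g φ w)) z :=
    (((hg.smooth φ hφ).contDiffAt (φ.open_target.mem_nhds hz)).of_le
      (WithTop.coe_le_coe.2 le_top)).log (hg.pos φ hφ z hz).ne'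
  have hu2 : ContDiffAt ℝ 2 (fun w => u (φ.symm w)) z :=
    ((contDiffOn_comp_symm hu hφ).contDiffAt (φ.open_target.mem_nhds hz)).of_le
      (WithTop.coe_le_coe.2 le_top)
  have h1 : (fun w => Real.log (conformalChange u g φ w)) =ᶠ[nhds z]
      ((2 : ℝ) • fun w => u (φ.symm w)) + fun w => Real.log (g φ w) := by
    filter_upwards [φ.open_target.mem_nhds hz] with w hw
    simp only [conformalChange, Pi.add_apply, Pi.smul_apply, smul_eq_mul]
    rw [Real.log_mul (Real.exp_pos _).ne' (hg.pos φ hφ w hw).ne', Real.log_exp]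
  have h2 : Laplacian.laplacian (fun w => Real.log (conformalChange u g φ w)) z =
      2 * Laplacian.laplacian (fun w => u (φ.symm w)) z +
        Laplacian.laplacian (fun w => Real.log (g φ w)) z := by
    rw [(InnerProductSpace.laplacian_congr_nhds h1).eq_of_nhds, ContDiffAt.laplacian_add
      (f₁ := (2 : ℝ) • fun w => u (φ.symm w)) (hu2.const_smul (2 : ℝ)) hlog,
      InnerProductSpace.laplacian_smul _ hu2]
    rfl
  have hp := (hg.pos φ hφ z hz).ne'
  have he := (Real.exp_pos (2 * u (φ.symm z))).ne'
  rw [gaussCurvature, h2, gaussCurvature]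
  simp only [conformalChange]
  field_simp
  ring

/-- The weight `e^{2u}` in `α` is chosen for this: squared, it cancels the `e^{4u}` coming from
`h²`. -/
theorem normSqQuad_conformalChange (κ : ℝ)
    {g : OpenPartialHomeomorph X ℂ → ℂ → ℝ} (hg : IsConformalMetric g) (u : X → ℝ)
    (b : LocalCoeffs X) {φ : OpenPartialHomeomorph X ℂ} (hφ : φ ∈ atlas ℂ X)
    {z : ℂ} (hz : z ∈ φ.target) :
    normSqQuad κ (conformalChange u g)
      (fun φ z => (Real.exp (2 * u (φ.symm z)) : ℂ) * conjDual g b φ z) φ z =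
      normSqBeltrami κ g b φ z := by
  have hp := (hg.pos φ hφ z hz).ne'
  have he := (Real.exp_pos (2 * u (φ.symm z))).ne'
  rw [normSqBeltrami_eq κ hg b hφ hz]
  simp only [normSqQuad, conjDual, conformalChange, norm_mul, Complex.norm_real,
    RCLike.norm_conj, mul_pow, Real.norm_eq_abs, sq_abs]
  field_simp

variable [IsManifold 𝓘(ℂ) ω X] [MeasurableSpace X] [BorelSpace X]

/-- The directions must vanish near each point outside the chart, not only at it, because the
density involves their first derivatives. -/
theorem firstVariation_eq_setIntegral (κ c : ℝ) {g : OpenPartialHomeomorph X ℂ → ℂ → ℝ}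
    (hg : IsConformalMetric g) {β : LocalCoeffs X} (hβ : IsSmoothTensor 1 (-1) β)
    {u : X → ℝ} (hu : ContMDiff 𝓘(ℝ, ℂ) 𝓘(ℝ, ℝ) ∞ u) {f : LocalCoeffs X}
    (hf : IsSmoothTensor 1 0 f) {v : X → ℝ} (hv : ContMDiff 𝓘(ℝ, ℂ) 𝓘(ℝ, ℝ) ∞ v)
    {w : LocalCoeffs X} (hw : IsSmoothTensor 1 0 w) {φ : OpenPartialHomeomorph X ℂ}
    (hφ : φ ∈ atlas ℂ X)
    (hv0 : ∀ ψ ∈ atlas ℂ X, ∀ z ∈ ψ.target, ψ.symm z ∉ φ.source →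
      (fun y => v (ψ.symm y)) =ᶠ[nhds z] fun _ => 0)
    (hw0 : ∀ ψ ∈ atlas ℂ X, ∀ z ∈ ψ.target, ψ.symm z ∉ φ.source → w ψ =ᶠ[nhds z] fun _ => 0) :
    firstVariation κ c g β u f v w =
      ∫ z in φ.target, g φ z * variationDensity κ c g β u f v w φ z := by
  rw [firstVariation, integral_areaMeasure_eq hg hφ
    (continuous_atPoint_variationDensity κ c hg hβ hu hf hv hw)]
  · refine setIntegral_congr_fun φ.open_target.measurableSet (fun z hz => ?_)
    rw [atPoint_eq (isScalar_variationDensity κ c hg hβ hu hf hv hw) hφ (φ.map_target hz),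
      φ.right_inv hz]
  · intro x hx
    have hx1 := mem_chart_target ℂ x
    have hx2 : (chartAt ℂ x).symm (chartAt ℂ x x) ∉ φ.source := by
      rwa [(chartAt ℂ x).left_inv (mem_chart_source ℂ x)]
    have h1 := hv0 _ (chart_mem_atlas ℂ x) _ hx1 hx2
    have h2 := hw0 _ (chart_mem_atlas ℂ x) _ hx1 hx2
    have h3 : wirtinger (fun y => (v ((chartAt ℂ x).symm y) : ℂ)) (chartAt ℂ x x) = 0 := by
      have : (fun y => (v ((chartAt ℂ x).symm y) : ℂ)) =ᶠ[nhds (chartAt ℂ x x)]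
          fun _ => 0 := by
        filter_upwards [h1] with y hy
        simp [hy]
      simp [wirtinger, this.fderiv_eq]
    have h4 : wirtingerBar (w (chartAt ℂ x)) (chartAt ℂ x x) = 0 := by
      simp [wirtingerBar, h2.fderiv_eq]
    simp only [atPoint, variationDensity, crossPartial, crossBeltrami, dbar, h3, h4,
      h1.eq_of_nhds]
    simp

variable [T2Space X]

/-- The Euler–Lagrange equation in the function. -/
theorem laplacian_eq_of_firstVariation_eq_zero {κ c : ℝ} {g : OpenPartialHomeomorph X ℂ → ℂ → ℝ}
    (hg : IsConformalMetric g) {β : LocalCoeffs X} (hβ : IsSmoothTensor 1 (-1) β)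
    {u : X → ℝ} (hu : ContMDiff 𝓘(ℝ, ℂ) 𝓘(ℝ, ℝ) ∞ u) {f : LocalCoeffs X}
    (hf : IsSmoothTensor 1 0 f)
    (h : ∀ v : X → ℝ, ContMDiff 𝓘(ℝ, ℂ) 𝓘(ℝ, ℝ) ∞ v → firstVariation κ c g β u f v 0 = 0)
    {φ : OpenPartialHomeomorph X ℂ} (hφ : φ ∈ atlas ℂ X) :
    ∀ z ∈ φ.target, g φ z * (gaussCurvature g φ z + 2 * Real.exp (2 * u (φ.symm z)) *
      (c + normSqBeltrami κ g (β + dbar f) φ z)) -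
        Laplacian.laplacian (fun w => u (φ.symm w)) z = 0 := by
  have hu1 := contDiffOn_comp_symm hu hφ
  have hR : ContinuousOn (fun z => g φ z * (gaussCurvature g φ z +
      2 * Real.exp (2 * u (φ.symm z)) * (c + normSqBeltrami κ g (β + dbar f) φ z))) φ.target := by
    have hB := (hβ.smooth φ hφ).add (contDiffOn_wirtingerBar φ.open_target (hf.smooth φ hφ))
    have hQ : ContinuousOn (fun z => normSqBeltrami κ g (β + dbar f) φ z) φ.target :=
      (continuousOn_const.mul (hB.continuousOn.norm.pow 2)).congr
        (fun z hz => normSqBeltrami_eq κ hg _ hφ hz)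
    exact (hg.smooth φ hφ).continuousOn.mul ((contDiffOn_gaussCurvature hg hφ).continuousOn.add
      ((continuousOn_const.mul (contDiffOn_const.mul hu1).exp.continuousOn).mul
        (continuousOn_const.add hQ)))
  have hΔ : ContinuousOn (Laplacian.laplacian (fun w => u (φ.symm w))) φ.target := by
    have h2 := ((hu1.fderiv_of_isOpen φ.open_target (m := ∞) (by simp)).fderiv_of_isOpen
      φ.open_target (m := ∞) (by simp)).continuousOn
    refine (((h2.clm_apply continuousOn_const).clm_apply continuousOn_const).add
      ((h2.clm_apply continuousOn_const).clm_apply continuousOn_const)).congr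
      (fun z _ => laplacian_eq_fderiv _ z)
  refine eq_zero_of_forall_integral_mul_eq_zero φ.open_target (hR.sub hΔ) ?_
  intro ρ hρ hc hs
  have hv := contMDiff_bumpFun hφ hρ hc hs
  have h1 := h _ hv
  rw [firstVariation_eq_setIntegral κ c hg hβ hu hf hv (isSmoothTensor_zero 1 0) hφ
    (fun ψ _ z hz hz' => bumpFun_eventuallyEq_zero hc hs hz hz')
    (fun ψ _ z _ _ => Filter.EventuallyEq.rfl)] at h1
  obtain ⟨h2, h3, h4⟩ := integral_fderiv_add_laplacian_eq_zero φ.open_target hu1 hρ hc hs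
  have h5 : IntegrableOn (fun z => g φ z * (gaussCurvature g φ z +
      2 * Real.exp (2 * u (φ.symm z)) * (c + normSqBeltrami κ g (β + dbar f) φ z)) * ρ z)
      φ.target :=
    (integrable_of_continuousOn_of_eq_zero hc hs (hR.mul hρ.continuous.continuousOn)
      (fun z hz => by simp [image_eq_zero_of_notMem_tsupport hz])).integrableOn
  -- Multiplied by the area density `g`, the gradient term loses its metric factor, so the flat
  -- integration by parts `h2` applies to it.
  have h6 : ∀ z ∈ φ.target,
      g φ z * variationDensity κ c g β u f (bumpFun φ ρ) 0 φ z =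
      (fderiv ℝ (fun w => u (φ.symm w)) z 1 * fderiv ℝ ρ z 1 +
        fderiv ℝ (fun w => u (φ.symm w)) z Complex.I * fderiv ℝ ρ z Complex.I) +
      g φ z * (gaussCurvature g φ z +
      2 * Real.exp (2 * u (φ.symm z)) * (c + normSqBeltrami κ g (β + dbar f) φ z)) * ρ z := by
    intro z hz
    have hp := (hg.pos φ hφ z hz).ne'
    have hloc : (fun w => (bumpFun φ ρ (φ.symm w) : ℂ)) =ᶠ[nhds z] fun w => (ρ w : ℂ) := by
      filter_upwards [φ.open_target.mem_nhds hz] with w hw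
      rw [bumpFun_symm φ ρ hw]
    have hwirt : wirtinger (fun w => (bumpFun φ ρ (φ.symm w) : ℂ)) z =
        wirtinger (fun w => (ρ w : ℂ)) z := by
      unfold wirtinger
      rw [hloc.fderiv_eq]
    rw [← four_mul_re_wirtinger ((hu1.contDiffAt (φ.open_target.mem_nhds hz)).differentiableAt
      (by simp)) (hρ.contDiffAt.differentiableAt (by simp))]
    simp only [variationDensity, crossPartial, crossBeltrami, dbar_zero, hwirt, bumpFun_symm φ ρ hz]
    simp only [Pi.zero_apply, mul_zero, Complex.zero_re, add_zero]
    field_simp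
    ring
  rw [setIntegral_congr_fun φ.open_target.measurableSet h6, integral_add h3 h5] at h1
  rw [integral_add h3 h4] at h2
  simp only [sub_mul]
  rw [integral_sub h5 h4]
  linarith

/-- The Euler–Lagrange equation in the vector field. -/
theorem wirtingerBar_eq_zero_of_firstVariation_eq_zero {κ c : ℝ} (hκ : 0 < κ)
    {g : OpenPartialHomeomorph X ℂ → ℂ → ℝ}
    (hg : IsConformalMetric g) {β : LocalCoeffs X} (hβ : IsSmoothTensor 1 (-1) β)
    {u : X → ℝ} (hu : ContMDiff 𝓘(ℝ, ℂ) 𝓘(ℝ, ℝ) ∞ u) {f : LocalCoeffs X}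
    (hf : IsSmoothTensor 1 0 f)
    (h : ∀ w : LocalCoeffs X, IsSmoothTensor 1 0 w → firstVariation κ c g β u f 0 w = 0)
    {φ : OpenPartialHomeomorph X ℂ} (hφ : φ ∈ atlas ℂ X) {α : ℂ → ℂ}
    (hα : α = fun z => (Real.exp (2 * u (φ.symm z)) : ℂ) * conjDual g (β + dbar f) φ z) :
    ContDiffOn ℝ ∞ α φ.target ∧ ∀ z ∈ φ.target, wirtingerBar α z = 0 := by
  have hu1 := contDiffOn_comp_symm hu hφ
  have hB := (hβ.smooth φ hφ).add (contDiffOn_wirtingerBar φ.open_target (hf.smooth φ hφ))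
  have hαs : ContDiffOn ℝ ∞ α φ.target := by
    rw [hα]
    exact (Complex.ofRealCLM.contDiff.comp_contDiffOn (contDiffOn_const.mul hu1).exp).mul
      ((Complex.ofRealCLM.contDiff.comp_contDiffOn (hg.smooth φ hφ)).mul
        (Complex.conjCLE.contDiff.comp_contDiffOn hB))
  have hαb := (contDiffOn_wirtingerBar φ.open_target hαs).continuousOn
  refine ⟨hαs, ?_⟩
  have key : ∀ ρ : ℂ → ℂ, ContDiff ℝ ∞ ρ → HasCompactSupport ρ → tsupport ρ ⊆ φ.target →
      ∫ z in φ.target, (wirtingerBar α z * ρ z).re = 0 := by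
    intro ρ hρ hc hs
    have hw := isSmoothTensor_bumpField hφ hρ hc hs
    have h1 : firstVariation κ c g β u f (fun _ => 0) (bumpField φ ρ) = 0 := h _ hw
    rw [firstVariation_eq_setIntegral κ c hg hβ hu hf (contMDiff_const (c := (0 : ℝ))) hw hφ
      (fun ψ _ z _ _ => Filter.EventuallyEq.rfl)
      (fun ψ _ z hz hz' => bumpField_eventuallyEq_zero hc hs hz hz')] at h1
    -- The factor `g` from the area form and `e^{2u}` combine with `conj (β + ∂̄f)` to give exactly
    -- `α`.
    have h6 : ∀ z ∈ φ.target,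
        g φ z * variationDensity κ c g β u f (fun _ => 0) (bumpField φ ρ) φ z =
        2 * κ * (α z * wirtingerBar ρ z).re := by
      intro z hz
      have hloc : bumpField φ ρ φ =ᶠ[nhds z] ρ := by
        filter_upwards [φ.open_target.mem_nhds hz] with w hw
        exact bumpField_self φ ρ hw
      have hwirt : wirtingerBar (bumpField φ ρ φ) z = wirtingerBar ρ z := by
        unfold wirtingerBar
        rw [hloc.fderiv_eq]
      simp only [variationDensity, crossPartial, crossBeltrami, dbar, hwirt, Complex.ofReal_zero,
        wirtinger_const, hα, conjDual, mul_zero, Complex.zero_re, zero_add, add_zero, mul_assoc,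
        zero_mul, Complex.re_ofReal_mul]
      ring
    obtain ⟨h2, h3, h4⟩ := integral_wirtingerBar_mul_add_eq_zero φ.open_target hαs hρ hc hs
    rw [setIntegral_congr_fun φ.open_target.measurableSet h6, integral_const_mul] at h1
    have h7 : ∫ z in φ.target, (α z * wirtingerBar ρ z).re = 0 := by
      -- Positivity of `κ` rules out the first factor.
      rcases mul_eq_zero.1 h1 with h | h
      · linarith
      · exact h
    have h8 := Complex.reCLM.integral_comp_comm h3
    have h9 := Complex.reCLM.integral_comp_comm h4
    simp only [Complex.reCLM_apply] at h8 h9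
    rw [h8, h2, Complex.neg_re, ← h9, h7, neg_zero]
  -- Only real parts are known to integrate to zero. Multiplying a real test function by `a = 1`
  -- isolates the real part of `∂̄α`, and `a = -I` its imaginary part.
  have hcast : ∀ (a : ℂ) (ρ : ℂ → ℝ), ContDiff ℝ ∞ ρ → HasCompactSupport ρ →
      tsupport ρ ⊆ φ.target → ∫ z in φ.target, (wirtingerBar α z * (a * ρ z)).re = 0 := by
    intro a ρ hρ hc hs
    have hsub : tsupport (fun z => a * (ρ z : ℂ)) ⊆ tsupport ρ := by
      refine closure_mono (fun z hz h0 => hz ?_)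
      simp [h0]
    exact key _ (contDiff_const.mul (Complex.ofRealCLM.contDiff.comp hρ))
      (hc.mono' (subset_closure.trans hsub)) (hsub.trans hs)
  have hre := eq_zero_of_forall_integral_mul_eq_zero φ.open_target
    (Complex.continuous_re.comp_continuousOn hαb) (fun ρ hρ hc hs => by
      rw [← hcast 1 ρ hρ hc hs]
      simp)
  have him := eq_zero_of_forall_integral_mul_eq_zero φ.open_target
    (Complex.continuous_im.comp_continuousOn hαb) (fun ρ hρ hc hs => by
      rw [← hcast (-Complex.I) ρ hρ hc hs]
      simp)
  intro z hz
  exact Complex.ext (hre z hz) (him z hz)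

theorem solvesGaussCodazzi_of_firstVariation_eq_zero {κ lam : ℝ} (hκ : 0 < κ)
    {g : OpenPartialHomeomorph X ℂ → ℂ → ℝ}
    (hg : IsConformalMetric g) {β : LocalCoeffs X} (hβ : IsSmoothTensor 1 (-1) β)
    {u : X → ℝ} (hu : ContMDiff 𝓘(ℝ, ℂ) 𝓘(ℝ, ℝ) ∞ u) {f : LocalCoeffs X}
    (hf : IsSmoothTensor 1 0 f)
    (h : ∀ (v : X → ℝ) (w : LocalCoeffs X), ContMDiff 𝓘(ℝ, ℂ) 𝓘(ℝ, ℝ) ∞ v →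
      IsSmoothTensor 1 0 w → firstVariation κ (-lam / 2) g β u f v w = 0) :
    SolvesGaussCodazzi κ lam (conformalChange u g)
      (fun φ z => (Real.exp (2 * u (φ.symm z)) : ℂ) * conjDual g (β + dbar f) φ z) where
  metric := isConformalMetric_conformalChange hg hu
  codazzi :=
    { transform := isTensor_exp_mul_conjDual hg u (hβ.transform.add (isTensor_dbar hf))
      holomorphic := fun φ hφ z hz => by
        obtain ⟨h1, h2⟩ := wirtingerBar_eq_zero_of_firstVariation_eq_zero hκ hg hβ hu hf
          (fun w hw => h 0 w contMDiff_const hw) hφ rfl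
        exact (differentiableAt_of_wirtingerBar_eq_zero
          ((h1.contDiffAt (φ.open_target.mem_nhds hz)).differentiableAt (by simp))
          (h2 z hz)).differentiableWithinAt }
  gauss φ hφ z hz := by
    have h1 := laplacian_eq_of_firstVariation_eq_zero hg hβ hu hf
      (fun v hv => h v 0 hv (isSmoothTensor_zero 1 0)) hφ z hz
    have h2 := gaussCurvature_conformalChange hg hu hφ hz
    rw [normSqQuad_conformalChange κ hg u _ hφ hz]
    have hpos := (mul_pos (Real.exp_pos (2 * u (φ.symm z))) (hg.pos φ hφ z hz)).ne'
    -- After multiplication by `e^{2u} g`, the Euler–Lagrange equation with `c = -λ/2` reads `g K(g)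
    -- - Δu = e^{2u} g (λ - 2|B|²)`.
    refine mul_left_cancel₀ hpos ?_
    rw [h2]
    linear_combination h1

end

end CMC

theorem mainTheorem4 {X : Type*} [TopologicalSpace X] [T2Space X] [CompactSpace X]
    [ChartedSpace ℂ X] [IsManifold 𝓘(ℂ) ω X] [MeasurableSpace X] [BorelSpace X]
    (κ : ℝ) (hκ : 0 < κ)
    (g : OpenPartialHomeomorph X ℂ → ℂ → ℝ) (hg : CMC.IsConformalMetric g)
    (β : CMC.LocalCoeffs X) (hβ : CMC.IsSmoothTensor 1 (-1) β)
    (C T : ℝ) (u : X → ℝ) (f : CMC.LocalCoeffs X)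
    (hcrit : CMC.IsCriticalPointOn (CMC.reducedFunctional κ g β C)
      (fun v _ => CMC.area g v = T) u f) :
    ∃ lam : ℝ,
      CMC.IsCriticalPointOn (CMC.donaldsonFunctional κ lam g β C) (fun _ _ => True) u f ∧
      CMC.SolvesGaussCodazzi κ lam (CMC.conformalChange u g)
        (fun φ z => (Real.exp (2 * u (φ.symm z)) : ℂ) * CMC.conjDual g (β + CMC.dbar f) φ z) := by
  obtain ⟨lam, h⟩ := CMC.exists_forall_firstVariation_eq_zero hg hβ hcrit
  exact ⟨lam, CMC.isCriticalPointOn_donaldsonFunctional hg hβ C hcrit.smooth_fun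
    hcrit.smooth_field h, CMC.solvesGaussCodazzi_of_firstVariation_eq_zero hκ hg hβ
    hcrit.smooth_fun hcrit.smooth_field h⟩
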